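/- Let $d\ge 2$ and $I=\{1,\dots,d\}$. A \emph{conformal iterated function system} (CS) with $d$ generators is a family $\Phi=(\phi_i:X\to \mathrm{Int}\,X)_{i\in I}$ of injective contractions of a non-empty compact connected set $X\subset\mathbb R$ into its interior such that * the sets $\phi_i(\mathrm{Int}\,X)\subset \mathrm{Int}\,X$, $i\in I$, are pairwise disjoint; * there are an open connected set $U\subset\mathbb C$ containing $X$ and conformal (holomorphic with non-vanishing derivative) extensions $\phi_i:U\to U$, $i\in I$, and a constant $C\ge 1$ with $|\phi_\omega'(w)|\le C|\phi_\omega'(z)|$ for all $n$, all $\omega=(\omega_1,\dots,\omega_n)\in I^n$ and all $z,w\in U$, where $\phi_\omega=\phi_{\omega_1}\circ\cdots\circ\phi_{\omega_n}$. Let $\Lambda(\Phi)=\bigcap_n\bigcup_{\omega\in I^n}\phi_\omega(X)$ be the limit set, $\Sigma_d=I^{\mathbb N}$ the full shift with left shift $\sigma$, $S_nf=\sum_{k<n}f\circ\sigma^k$, and let $\pi_\Phi:\Sigma_d\to\Lambda(\Phi)$ be the coding map, $\{\pi_\Phi(x)\}=\bigcap_n\phi_{x_1\cdots x_n}(X)$.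 Put $$I_\Phi(x)=\log|\phi_{x_1}'(\pi_\Phi(\sigma x))|,\qquad P_\Phi(u)=\lim_{n\to\infty}\frac1n\log\sum_{\omega\in I^n}\exp\Big(\sup_{x\in[\omega]}u\,S_nI_\Phi(x)\Big)\quad(u\in\mathbb R),$$ $$\ell_\Phi(\alpha)=\dim_H\,\pi_\Phi\Big(\Big\{x\in\Sigma_d:\lim_{n\to\infty}\frac{S_nI_\Phi(x)}{-n}=\alpha\Big\}\Big)\quad(\alpha\in\mathbb R).$$ For $u\in\mathbb R$ let $\mu_{\Phi,u}$ be the $\sigma$-invariant Gibbs measure of $uI_\Phi-P_\Phi(u)$, that is, the $\sigma$-invariant Borel probability measure on $\Sigma_d$ for which there is $C\ge1$ with $C^{-1}e^{uS_nI_\Phi(x)-nP_\Phi(u)}\le\mu_{\Phi,u}([\omega])\le C e^{uS_nI_\Phi(x)-nP_\Phi(u)}$ for all $n$, $\omega\in I^n$ and $x\in[\omega]$. A CS $\Psi=(\psi_i)$ is a \emph{deformation} of a CS $\Phi=(\phi_i)$ if there is a bi-Lipschitz bijection $h:\Lambda(\Phi)\to\Lambda(\Psi)$ with $\psi_i=h\circ\phi_i\circ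 h^{-1}$ on $\Lambda(\Psi)$ for each $i\in I$. For CS $\Phi,\Psi$ with $d$ generators we write, in each case for some system $\Psi_0$ obtained from $\Psi$ by a permutation of its generators: * $\Phi\sim\Psi$ (equivalent) if $\Psi_0$ is a deformation of $\Phi$; * $\mu_{\Phi,u}\cong\mu_{\Psi,v}$ if $\mu_{\Phi,u}=\mu_{\Psi_0,v}$; * $I_\Phi\simeq I_\Psi$ if $I_\Phi-I_{\Psi_0}=e-e\circ\sigma$ for some continuous $e:\Sigma_d\to\mathbb R$. A CS is \emph{affine} if all its generators are affine on $X$, \emph{essentially affine} (EAS) if it is a deformation of an affine CS, and \emph{degenerate} if it is equivalent to an affine CS all of whose generators have the same derivative. \textbf{Theorem (Multifractal rigidity for EAS).} Let $\Phi,\Psi$ be non-degenerate essentially affine systems with $d$ generators. The following are equivalent: 1. $\mu_{\Phi,u}\cong\mu_{\Psi,u}$ and $P_\Phi(u)=P_\Psi(u)$, for some $u\in\mathbb R\setminus\{0\}$; 2. $\Phi\sim\Psi$; 3. $I_\Phi\simeq I_\Psi$; 4. $P_\Phi=P_\Psi$; 5. $\ell_\Phi=\ell_\Psi$. -/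

import Mathlib

open Set Filter Topology MeasureTheory

/-- The composition `f (ω 0) ∘ f (ω 1) ∘ ⋯ ∘ f (ω (n-1))` along a finite word `ω`. -/
def wordMap {ι α : Type*} (f : ι → α → α) : (n : ℕ) → (Fin n → ι) → α → α
  | 0, _ => id
  | n + 1, ω => f (ω 0) ∘ wordMap f n (fun k => ω k.succ)

theorem wordMap_reindex {ι κ α : Type*} (f : ι → α → α) (g : κ → ι) :
    ∀ (n : ℕ) (ω : Fin n → κ),
      wordMap (fun i => f (g i)) n ω = wordMap f n (fun k => g (ω k))
  | 0, _ => rfl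
  | n + 1, ω => by
      simp only [wordMap]
      rw [wordMap_reindex f g n]

/-- A conformal iterated function system (CS) with `d` generators on a compact connected set
`X ⊂ ℝ`. The generators are total functions `ℝ → ℝ` of which only the restrictions to `X` matter.
-/
structure ConformalIFS (d : ℕ) where
  /-- The compact interval on which the system lives. -/
  X : Set ℝ
  /-- The generators. -/
  map : Fin d → ℝ → ℝ
  isCompact_X : IsCompact X
  isConnected_X : IsConnected X
  mapsTo_interior : ∀ i, MapsTo (map i) X (interior X)
  injOn : ∀ i, InjOn (map i) X
  contraction : ∀ i, ∃ K : NNReal, K < 1 ∧ LipschitzOnWith K (map i) X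
  /-- Open set condition; the inclusions of the images in `interior X` follow from
  `mapsTo_interior`. -/
  openSet : ∀ i j, i ≠ j → Disjoint (map i '' interior X) (map j '' interior X)
  /-- Conformality condition and bounded distortion property, on a common complex neighbourhood
  `U` of `X`: each generator extends to a conformal map `F i : U → U` (holomorphic with
  non-vanishing derivative), and the derivatives of all compositions of the extensions have
  uniformly bounded distortion on `U`. -/
  conformal : ∃ (U : Set ℂ) (F : Fin d → ℂ → ℂ),
    IsOpen U ∧ IsConnected U ∧ (∀ x ∈ X, (x : ℂ) ∈ U) ∧
    (∀ i, MapsTo (F i) U U ∧ DifferentiableOn ℂ (F i) U ∧ (∀ z ∈ U, deriv (F i) z ≠ 0) ∧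
      ∀ x ∈ X, F i (x : ℂ) = ((map i x : ℝ) : ℂ)) ∧
    ∃ C : ℝ, 1 ≤ C ∧ ∀ (n : ℕ) (ω : Fin n → Fin d), ∀ z ∈ U, ∀ w ∈ U,
      ‖deriv (wordMap F n ω) w‖ ≤ C * ‖deriv (wordMap F n ω) z‖

/-- The left shift on the full shift `Σ_d = {1, …, d}^ℕ`. -/
def leftShift {d : ℕ} (x : ℕ → Fin d) : ℕ → Fin d := fun n => x (n + 1)

/-- The cylinder set of a finite word. -/
def cylinderSet {d n : ℕ} (ω : Fin n → Fin d) : Set (ℕ → Fin d) :=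
  {x | ∀ k : Fin n, x k = ω k}

/-- The topological pressure of a potential on the full shift. -/
noncomputable def topPressure {d : ℕ} (f : (ℕ → Fin d) → ℝ) : ℝ :=
  limUnder atTop fun n : ℕ =>
    (1 / (n : ℝ)) * Real.log (∑ ω : Fin n → Fin d,
      Real.exp (sSup (birkhoffSum leftShift f n '' cylinderSet ω)))

/-- Two functions on the full shift are cohomologous if they differ by a continuous coboundary. -/
def IsCohomologous {d : ℕ} (f g : (ℕ → Fin d) → ℝ) : Prop :=
  ∃ e : (ℕ → Fin d) → ℝ, Continuous e ∧ ∀ x, f x - g x = e x - e (leftShift x)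

namespace ConformalIFS

variable {d : ℕ}

/-- The system obtained by permuting the generators. -/
def permute (Φ : ConformalIFS d) (τ : Equiv.Perm (Fin d)) : ConformalIFS d where
  X := Φ.X
  map i := Φ.map (τ i)
  isCompact_X := Φ.isCompact_X
  isConnected_X := Φ.isConnected_X
  mapsTo_interior i := Φ.mapsTo_interior (τ i)
  injOn i := Φ.injOn (τ i)
  contraction i := Φ.contraction (τ i)
  openSet i j hij := Φ.openSet (τ i) (τ j) (fun h => hij (τ.injective h))
  conformal := by
    obtain ⟨U, F, hU, hUc, hX, hF, C, hC, hD⟩ := Φ.conformal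
    refine ⟨U, fun i => F (τ i), hU, hUc, hX, fun i => hF (τ i), C, hC, ?_⟩
    intro n ω z hz w hw
    rw [wordMap_reindex F τ n ω]
    exact hD n _ z hz w hw

/-- The limit set `Λ(Φ)`. -/
def limitSet (Φ : ConformalIFS d) : Set ℝ :=
  ⋂ n : ℕ, ⋃ ω : Fin n → Fin d, wordMap Φ.map n ω '' Φ.X

theorem wordMap_mapsTo (Φ : ConformalIFS d) :
    ∀ (n : ℕ) (ω : Fin n → Fin d), MapsTo (wordMap Φ.map n ω) Φ.X Φ.X
  | 0, _ => fun _ hx => hx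
  | n + 1, ω => fun _ hx =>
      interior_subset (Φ.mapsTo_interior (ω 0) (Φ.wordMap_mapsTo n _ hx))

theorem wordMap_snoc (f : Fin d → ℝ → ℝ) :
    ∀ (n : ℕ) (ω : Fin (n + 1) → Fin d),
      wordMap f (n + 1) ω = wordMap f n (fun k => ω k.castSucc) ∘ f (ω (Fin.last n))
  | 0, _ => rfl
  | n + 1, ω => by
      have h := wordMap_snoc f n (fun k => ω k.succ)
      change f (ω 0) ∘ wordMap f (n + 1) (fun k => ω k.succ) = _
      rw [h]
      rfl

theorem wordMap_lipschitz (Φ : ConformalIFS d) {K : NNReal}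
    (hK : ∀ i, LipschitzOnWith K (Φ.map i) Φ.X) :
    ∀ (n : ℕ) (ω : Fin n → Fin d), LipschitzOnWith (K ^ n) (wordMap Φ.map n ω) Φ.X
  | 0, _ => by
      simpa [wordMap] using (LipschitzWith.id (α := ℝ)).lipschitzOnWith (s := Φ.X)
  | n + 1, ω => by
      rw [pow_succ']
      exact (hK (ω 0)).comp (Φ.wordMap_lipschitz hK n _) (Φ.wordMap_mapsTo n _)

/-- For every sequence `x`, the sets `φ_{x_1} ∘ ⋯ ∘ φ_{x_n} (X)` shrink to exactly one point. -/
theorem existsUnique_coding (Φ : ConformalIFS d) (x : ℕ → Fin d) :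
    ∃! p : ℝ, ∀ n : ℕ, p ∈ wordMap Φ.map n (fun k => x k) '' Φ.X := by
  choose K hK1 hKL using Φ.contraction
  have hne : (Finset.univ : Finset (Fin d)).Nonempty := ⟨x 0, Finset.mem_univ _⟩
  let L : NNReal := Finset.univ.sup' hne K
  have hL1 : L < 1 := by
    simp only [L, Finset.sup'_lt_iff]
    exact fun i _ => hK1 i
  have hL : ∀ i, LipschitzOnWith L (Φ.map i) Φ.X := fun i =>
    (hKL i).weaken (Finset.le_sup' K (Finset.mem_univ i))
  have hlip := Φ.wordMap_lipschitz hL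
  have hcomp : ∀ n : ℕ, IsCompact (wordMap Φ.map n (fun k => x k) '' Φ.X) := fun n =>
    Φ.isCompact_X.image_of_continuousOn (hlip n _).continuousOn
  obtain ⟨p, hp⟩ := IsCompact.nonempty_iInter_of_sequence_nonempty_isCompact_isClosed
    (fun n : ℕ => wordMap Φ.map n (fun k => x k) '' Φ.X)
    (fun n => by
      rw [wordMap_snoc, image_comp]
      exact image_mono ((Φ.mapsTo_interior _).image_subset.trans interior_subset))
    (fun n => Φ.isConnected_X.nonempty.image _) (hcomp 0) (fun n => (hcomp n).isClosed)
  rw [mem_iInter] at hp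
  refine ⟨p, hp, fun q hq => ?_⟩
  obtain ⟨B, hB⟩ := Metric.isBounded_iff.1 Φ.isCompact_X.isBounded
  have hle : ∀ n : ℕ, dist q p ≤ (L : ℝ) ^ n * B := by
    intro n
    obtain ⟨a, ha, rfl⟩ := hq n
    obtain ⟨b, hb, hbp⟩ := hp n
    rw [← hbp]
    refine ((hlip n _).dist_le_mul a ha b hb).trans ?_
    rw [NNReal.coe_pow]
    exact mul_le_mul_of_nonneg_left (hB ha hb) (by positivity)
  have hlim : Tendsto (fun n : ℕ => (L : ℝ) ^ n * B) atTop (𝓝 (0 * B)) :=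
    (tendsto_pow_atTop_nhds_zero_of_lt_one L.coe_nonneg (by exact_mod_cast hL1)).mul_const B
  rw [zero_mul] at hlim
  exact dist_le_zero.1 (ge_of_tendsto' hlim hle)

/-- The coding map `π_Φ`, sending `x` to the point to which `φ_{x_1} ∘ ⋯ ∘ φ_{x_n} (X)` shrinks. -/
noncomputable def coding (Φ : ConformalIFS d) (x : ℕ → Fin d) : ℝ :=
  (Φ.existsUnique_coding x).choose

/-- The canonical geometric potential `I_Φ(x) = log |φ_{x_1}'(π_Φ(σ x))|`. The point `π_Φ(σ x)`
is interior to `X`, and `Real.log` is the logarithm of the absolute value. -/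
noncomputable def potential (Φ : ConformalIFS d) (x : ℕ → Fin d) : ℝ :=
  Real.log (deriv (Φ.map (x 0)) (Φ.coding (leftShift x)))

/-- The pressure function `P_Φ(u)`, the topological pressure of `u I_Φ`. -/
noncomputable def pressure (Φ : ConformalIFS d) (u : ℝ) : ℝ :=
  topPressure fun x => u * Φ.potential x

/-- `μ` is the shift-invariant Gibbs measure `μ_{Φ,u}` of the potential `u I_Φ - P_Φ(u)`. -/
def IsGibbsMeasure (Φ : ConformalIFS d) (u : ℝ) (μ : Measure (ℕ → Fin d)) : Prop :=
  IsProbabilityMeasure μ ∧ MeasurePreserving leftShift μ μ ∧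
  ∃ C : ℝ, 1 ≤ C ∧ ∀ (n : ℕ) (ω : Fin n → Fin d), ∀ x ∈ cylinderSet ω,
    C⁻¹ * Real.exp (u * birkhoffSum leftShift Φ.potential n x - n * Φ.pressure u)
        ≤ μ.real (cylinderSet ω) ∧
    μ.real (cylinderSet ω)
        ≤ C * Real.exp (u * birkhoffSum leftShift Φ.potential n x - n * Φ.pressure u)

/-- `μ_{Φ,u} ≅ μ_{Ψ,v}`: for some permutation of the generators of `Ψ`, the two invariant Gibbs
measures are the same measure. -/
def GibbsEqualUpToPerm (Φ : ConformalIFS d) (u : ℝ) (Ψ : ConformalIFS d) (v : ℝ) : Prop :=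
  ∃ τ : Equiv.Perm (Fin d), ∃ μ : Measure (ℕ → Fin d),
    Φ.IsGibbsMeasure u μ ∧ (Ψ.permute τ).IsGibbsMeasure v μ

/-- `I_Φ ≃ I_Ψ`: cohomologous after some permutation of the generators of `Ψ`. -/
def PotentialEquiv (Φ Ψ : ConformalIFS d) : Prop :=
  ∃ τ : Equiv.Perm (Fin d), IsCohomologous Φ.potential (Ψ.permute τ).potential

/-- The Lyapunov spectrum `ℓ_Φ`. -/
noncomputable def lyapunovSpectrum (Φ : ConformalIFS d) (α : ℝ) : ENNReal :=
  dimH (Φ.coding '' {x | Tendsto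
    (fun n : ℕ => birkhoffSum leftShift Φ.potential n x / (-(n : ℝ))) atTop (𝓝 α)})

/-- `Ψ` is a deformation of `Φ`: there is a fractal boundary correspondence, that is, a
bi-Lipschitz bijection `h : Λ(Φ) → Λ(Ψ)` with `ψ_i = h ∘ φ_i ∘ h⁻¹` on `Λ(Ψ)` for all `i`. -/
def IsDeformation (Φ Ψ : ConformalIFS d) : Prop :=
  ∃ h : ℝ → ℝ, BijOn h Φ.limitSet Ψ.limitSet ∧
    (∃ L : ℝ, 1 ≤ L ∧ ∀ x ∈ Φ.limitSet, ∀ y ∈ Φ.limitSet,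
      L⁻¹ * |x - y| ≤ |h x - h y| ∧ |h x - h y| ≤ L * |x - y|) ∧
    ∀ i, ∀ x ∈ Φ.limitSet, h (Φ.map i x) = Ψ.map i (h x)

/-- `Φ ∼ Ψ`: after some permutation of the generators of `Ψ` there is a fractal boundary
correspondence between the two systems. -/
def Equivalent (Φ Ψ : ConformalIFS d) : Prop :=
  ∃ τ : Equiv.Perm (Fin d), Φ.IsDeformation (Ψ.permute τ)

/-- Affine iterated function systems (AS). -/
def IsAffine (Φ : ConformalIFS d) : Prop :=
  ∀ i, ∃ a b : ℝ, ∀ x ∈ Φ.X, Φ.map i x = a * x + b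

/-- Essentially affine iterated function systems (EAS): deformations of affine ones. -/
def IsEssentiallyAffine (Φ : ConformalIFS d) : Prop :=
  ∃ Θ : ConformalIFS d, Θ.IsAffine ∧ Θ.IsDeformation Φ

/-- Degenerate systems: equivalent to an affine system all of whose generators have the same
derivative. -/
def IsDegenerate (Φ : ConformalIFS d) : Prop :=
  ∃ Θ : ConformalIFS d, Θ.IsAffine ∧
    (∀ i j, ∀ x ∈ interior Θ.X, deriv (Θ.map i) x = deriv (Θ.map j) x) ∧ Φ.Equivalent Θ

end ConformalIFS

/-!
# Multifractal rigidity for essentially affine systems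

The limit set of a conformal system lies in the interior of `X`, so its first level pieces are
disjoint compact sets, hence at positive distance from each other. With the mean value theorem and
bounded distortion, two points whose codes first differ at position `n` are at distance comparable
to `exp (S_n I_Φ)` (`exists_dist_coding_comparable`). Consequently the natural conjugacy between two
limit sets is bi-Lipschitz exactly when the Birkhoff sums of the two geometric potentials stay at
bounded distance (`isDeformation_iff_birkhoffSum_bounded`). By Livsic's theorem for the Hölder
continuous geometric potentials, this is also equivalent to their being cohomologous
(`isCohomologous_potential_iff_birkhoffSum_bounded`).

For an affine system the geometric potential depends on the first symbol only. An essentially affine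
system therefore has *rates* `r i > 0` such that `S_n I_Φ x = -∑ k < n, r (x k)` up to a bounded
error (`HasRates`), and every item of the theorem amounts to the rates of the two systems agreeing
up to a permutation:

* rates can be read off from Birkhoff sums along constant sequences, and a Gibbs measure with its
  pressure determines Birkhoff sums up to bounded errors (`birkhoffSum_bounded_of_isGibbsMeasure`);
  conversely the Bernoulli measure with weights proportional to `exp (-u r i)` is a Gibbs measure
  for every system with rates `r` (`HasRates.isGibbsMeasure`);
* the pressure is `P(u) = log ∑ exp (-u r i)`, whose values at the natural numbers give the power
  sums of the numbers `exp (-r i)`, and power sums determine a finite family up to a permutation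
  (`HasRates.exists_perm_of_pressure_eq`);
* the Lyapunov spectrum determines the pressure by Legendre duality: `α ℓ(α) ≤ P(u) + u α` for all
  `u` and all `α` with `ℓ(α) > 0`, by coverings with cylinder sets (`HasRates.lyapunovSpectrum_le`),
  and for every `u` equality holds at some `α > 0` with `ℓ(α) > 0`, by the mass distribution
  principle for the Bernoulli measure above (`HasRates.exists_le_lyapunovSpectrum`). So
  `P(u) = max (α ℓ(α) - u α)` over the `α > 0` with `ℓ(α) > 0`.
-/

namespace ConformalIFS

variable {d : ℕ}

/-! ### The coding map and its metric properties -/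

theorem coding_mem (Φ : ConformalIFS d) (x : ℕ → Fin d) (n : ℕ) :
    Φ.coding x ∈ wordMap Φ.map n (fun k => x k) '' Φ.X :=
  (Φ.existsUnique_coding x).choose_spec.1 n

theorem coding_eq (Φ : ConformalIFS d) {x : ℕ → Fin d} {p : ℝ}
    (hp : ∀ n : ℕ, p ∈ wordMap Φ.map n (fun k => x k) '' Φ.X) : Φ.coding x = p :=
  (Φ.existsUnique_coding x).unique (Φ.coding_mem x) hp

theorem coding_mem_X (Φ : ConformalIFS d) (x : ℕ → Fin d) : Φ.coding x ∈ Φ.X := by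
  simpa [wordMap] using Φ.coding_mem x 0

theorem map_coding (Φ : ConformalIFS d) (x : ℕ → Fin d) :
    Φ.map (x 0) (Φ.coding (leftShift x)) = Φ.coding x := by
  refine (Φ.coding_eq fun n => ?_).symm
  cases n with
  | zero =>
    simpa [wordMap] using interior_subset (Φ.mapsTo_interior (x 0) (Φ.coding_mem_X _))
  | succ n =>
    obtain ⟨q, hq, hqe⟩ := Φ.coding_mem (leftShift x) n
    exact ⟨q, hq, by rw [← hqe]; rfl⟩

theorem coding_mem_interior (Φ : ConformalIFS d) (x : ℕ → Fin d) :
    Φ.coding x ∈ interior Φ.X := by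
  rw [← Φ.map_coding x]
  exact Φ.mapsTo_interior _ (Φ.coding_mem_X _)

theorem iterate_leftShift_apply (n : ℕ) (x : ℕ → Fin d) (k : ℕ) :
    leftShift^[n] x k = x (k + n) := by
  induction n generalizing x with
  | zero => rfl
  | succ n ih => rw [Function.iterate_succ_apply, ih]; rfl

theorem wordMap_coding (Φ : ConformalIFS d) (n : ℕ) (x : ℕ → Fin d) :
    wordMap Φ.map n (fun k => x k) (Φ.coding (leftShift^[n] x)) = Φ.coding x := by
  induction n generalizing x with
  | zero => rfl
  | succ n ih =>
    rw [← Φ.map_coding x, ← ih (leftShift x)]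
    rfl

theorem wordMap_congr (Φ : ConformalIFS d) {n : ℕ} {x y : ℕ → Fin d}
    (h : ∀ k < n, x k = y k) :
    wordMap Φ.map n (fun k => x k) = wordMap Φ.map n (fun k => y k) := by
  congr 1
  funext k
  exact h k k.2

theorem exists_uniform_contraction (Φ : ConformalIFS d) [Nonempty (Fin d)] :
    ∃ K : NNReal, K < 1 ∧ ∀ i, LipschitzOnWith K (Φ.map i) Φ.X := by
  choose K hK1 hKL using Φ.contraction
  have hne : (Finset.univ : Finset (Fin d)).Nonempty := Finset.univ_nonempty
  refine ⟨Finset.univ.sup' hne K, ?_, fun i =>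
    (hKL i).weaken (Finset.le_sup' K (Finset.mem_univ i))⟩
  rw [Finset.sup'_lt_iff]
  exact fun i _ => hK1 i

/-- Points of the same level `n` cylinder set have codings at distance at most a constant times
`θ ^ n`. -/
theorem exists_dist_coding_le (Φ : ConformalIFS d) [Nonempty (Fin d)] :
    ∃ θ B : ℝ, 0 ≤ θ ∧ θ < 1 ∧ 0 ≤ B ∧
      (∀ (n : ℕ) (ω : Fin n → Fin d), ∀ p ∈ wordMap Φ.map n ω '' Φ.X,
        ∀ q ∈ wordMap Φ.map n ω '' Φ.X, |p - q| ≤ B * θ ^ n) ∧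
      ∀ (n : ℕ) (x y : ℕ → Fin d), (∀ k < n, x k = y k) →
        |Φ.coding x - Φ.coding y| ≤ B * θ ^ n := by
  obtain ⟨K, hK1, hK⟩ := Φ.exists_uniform_contraction
  obtain ⟨B, hB⟩ := Metric.isBounded_iff.1 Φ.isCompact_X.isBounded
  obtain ⟨p, hp⟩ := Φ.isConnected_X.nonempty
  have hB0 : 0 ≤ B := dist_nonneg.trans (hB hp hp)
  have key : ∀ (n : ℕ) (ω : Fin n → Fin d), ∀ p ∈ wordMap Φ.map n ω '' Φ.X,
        ∀ q ∈ wordMap Φ.map n ω '' Φ.X, |p - q| ≤ B * (K : ℝ) ^ n := by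
    rintro n ω _ ⟨a, ha, rfl⟩ _ ⟨b, hb, rfl⟩
    have h := (Φ.wordMap_lipschitz hK n ω).dist_le_mul a ha b hb
    rw [← Real.dist_eq]
    refine h.trans ?_
    rw [NNReal.coe_pow, mul_comm]
    exact mul_le_mul_of_nonneg_right (hB ha hb) (by positivity)
  refine ⟨K, B, K.coe_nonneg, by exact_mod_cast hK1, hB0, key, fun n x y hxy => ?_⟩
  refine key n (fun k => x k) _ (Φ.coding_mem x n) _ ?_
  rw [Φ.wordMap_congr hxy]
  exact Φ.coding_mem y n

/-- Sequences agreeing on the first `n` symbols with `x` form a neighbourhood of `x`. -/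
theorem eventually_agree (x : ℕ → Fin d) (n : ℕ) :
    ∀ᶠ y in 𝓝 x, ∀ k < n, y k = x k := by
  have h : ∀ k ∈ Finset.range n, ∀ᶠ y in 𝓝 x, y k = x k := fun k _ =>
    (continuous_apply k).continuousAt.eventually
      (mem_nhds_discrete.2 (mem_singleton (x k)))
  filter_upwards [(Finset.eventually_all (Finset.range n)).2 h] with y hy k hk
  exact hy k (Finset.mem_range.2 hk)

/-- A function on the full shift whose oscillation on cylinder sets of level `n + 1` tends to
`0` is continuous. -/
theorem continuous_of_agree {f : (ℕ → Fin d) → ℝ} {b : ℕ → ℝ} (hb : Tendsto b atTop (𝓝 0))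
    (hf : ∀ (n : ℕ) (x y : ℕ → Fin d), (∀ k < n + 1, x k = y k) →
      |f x - f y| ≤ b n) :
    Continuous f := by
  refine continuous_iff_continuousAt.2 fun x => Metric.tendsto_nhds.2 fun ε hε => ?_
  obtain ⟨n, hn⟩ := (hb.eventually (gt_mem_nhds hε)).exists
  filter_upwards [eventually_agree x (n + 1)] with y hy
  exact (hf n y x hy).trans_lt hn

theorem continuous_coding (Φ : ConformalIFS d) : Continuous Φ.coding := by
  rcases isEmpty_or_nonempty (Fin d) with h | h
  · exact continuous_of_const fun x => (h.false (x 0)).elim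
  obtain ⟨θ, B, h0, h1, -, -, h⟩ := Φ.exists_dist_coding_le
  refine continuous_of_agree (b := fun n => B * θ ^ n) ?_
    fun n x y hxy => h n x y fun k hk => hxy k (hk.trans (Nat.lt_succ_self n))
  simpa using (tendsto_pow_atTop_nhds_zero_of_lt_one h0 h1).const_mul B

/-- The images of `interior X` are disjoint, and codings lie in `interior X`. -/
theorem coding_ne_of_head_ne (Φ : ConformalIFS d) {x y : ℕ → Fin d} (h : x 0 ≠ y 0) :
    Φ.coding x ≠ Φ.coding y := by
  intro he
  exact Set.disjoint_left.1 (Φ.openSet _ _ h) ⟨_, Φ.coding_mem_interior _, Φ.map_coding x⟩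
    ⟨_, Φ.coding_mem_interior _, by rw [Φ.map_coding y, he]⟩

/-- Strong separation: the first level pieces of the limit set are at positive distance from each
other, because the limit set is contained in the interior of `X`. -/
theorem exists_separation (Φ : ConformalIFS d) :
    ∃ δ > 0, ∀ x y : ℕ → Fin d, x 0 ≠ y 0 → δ ≤ |Φ.coding x - Φ.coding y| := by
  let S : Set ((ℕ → Fin d) × (ℕ → Fin d)) := {p | p.1 0 ≠ p.2 0}
  have hS : IsCompact S := by
    refine IsClosed.isCompact ?_
    have : IsClosed ((fun p : (ℕ → Fin d) × (ℕ → Fin d) => (p.1 0, p.2 0)) ⁻¹'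
        {q : Fin d × Fin d | q.1 ≠ q.2}) :=
      (isClosed_discrete _).preimage (by fun_prop)
    exact this
  rcases S.eq_empty_or_nonempty with he | hne
  · exact ⟨1, one_pos, fun x y hxy => by
      have : (x, y) ∈ S := hxy
      rw [he] at this
      exact this.elim⟩
  have hc : Continuous fun p : (ℕ → Fin d) × (ℕ → Fin d) => |Φ.coding p.1 - Φ.coding p.2| := by
    have := Φ.continuous_coding
    fun_prop
  obtain ⟨p, hp, hmin⟩ := hS.exists_isMinOn hne hc.continuousOn
  exact ⟨_, abs_pos.2 (sub_ne_zero.2 (Φ.coding_ne_of_head_ne hp)), fun x y hxy =>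
    hmin (show (x, y) ∈ S from hxy)⟩

/-- The limit set is the image of the full shift under the coding map. -/
theorem limitSet_eq_range_coding (Φ : ConformalIFS d) [Nonempty (Fin d)] :
    Φ.limitSet = range Φ.coding := by
  refine Subset.antisymm (fun p hp => ?_) ?_
  · have hcl : IsClosed (range Φ.coding) := (isCompact_range Φ.continuous_coding).isClosed
    rw [← hcl.closure_eq]
    obtain ⟨θ, B, h0, h1, -, h, -⟩ := Φ.exists_dist_coding_le
    refine Metric.mem_closure_iff.2 fun ε hε => ?_
    have ht : Tendsto (fun n : ℕ => B * θ ^ n) atTop (𝓝 0) := by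
      simpa using (tendsto_pow_atTop_nhds_zero_of_lt_one h0 h1).const_mul B
    obtain ⟨n, hn⟩ := (ht.eventually (gt_mem_nhds hε)).exists
    obtain ⟨ω, hω⟩ := mem_iUnion.1 (mem_iInter.1 hp n)
    obtain ⟨i⟩ := ‹Nonempty (Fin d)›
    let x : ℕ → Fin d := fun k => if hk : k < n then ω ⟨k, hk⟩ else i
    refine ⟨Φ.coding x, mem_range_self x, ?_⟩
    rw [Real.dist_eq]
    refine (h n ω p hω _ ?_).trans_lt hn
    have hx : (fun k : Fin n => x k) = ω := by
      funext k
      simp [x]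
    exact hx ▸ Φ.coding_mem x n
  · rintro _ ⟨x, rfl⟩
    exact mem_iInter.2 fun n => mem_iUnion.2 ⟨_, Φ.coding_mem x n⟩

/-- The real derivative of a real function with a complex differentiable extension. -/
theorem hasDerivAt_of_complex_extension {G : ℂ → ℂ} {g : ℝ → ℝ} {p : ℝ}
    (hG : DifferentiableAt ℂ G p) (hg : ∀ᶠ x : ℝ in 𝓝 p, G x = (g x : ℂ)) :
    DifferentiableAt ℝ g p ∧ deriv G p = (deriv g p : ℝ) := by
  have h1 : HasDerivAt g (deriv G p).re p := by
    refine hG.hasDerivAt.real_of_complex.congr_of_eventuallyEq ?_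
    filter_upwards [hg] with x hx
    rw [hx, Complex.ofReal_re]
  have h2 : HasDerivAt (fun x : ℝ => (g x : ℂ)) (deriv G p) p := by
    refine hG.hasDerivAt.comp_ofReal.congr_of_eventuallyEq ?_
    filter_upwards [hg] with x hx
    rw [hx]
  refine ⟨h1.differentiableAt, ?_⟩
  rw [h1.deriv]
  exact h2.unique h1.ofReal_comp

/-- On the interior of `X` all compositions of generators are differentiable, with non-vanishing
derivatives of uniformly bounded distortion. -/
theorem exists_distortion (Φ : ConformalIFS d) :
    (∀ (n : ℕ) (ω : Fin n → Fin d), ∀ p ∈ interior Φ.X,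
      DifferentiableAt ℝ (wordMap Φ.map n ω) p ∧ deriv (wordMap Φ.map n ω) p ≠ 0) ∧
    ∃ C : ℝ, 1 ≤ C ∧ ∀ (n : ℕ) (ω : Fin n → Fin d), ∀ p ∈ interior Φ.X, ∀ q ∈ interior Φ.X,
      |deriv (wordMap Φ.map n ω) p| ≤ C * |deriv (wordMap Φ.map n ω) q| := by
  obtain ⟨U, F, hU, -, hXU, hF, C, hC, hD⟩ := Φ.conformal
  have hmaps : ∀ (n : ℕ) (ω : Fin n → Fin d), MapsTo (wordMap F n ω) U U := by
    intro n
    induction n with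
    | zero => exact fun _ z hz => hz
    | succ n ih => exact fun ω z hz => (hF (ω 0)).1 (ih _ hz)
  have hdiff : ∀ (n : ℕ) (ω : Fin n → Fin d), ∀ z ∈ U,
      DifferentiableAt ℂ (wordMap F n ω) z ∧ deriv (wordMap F n ω) z ≠ 0 := by
    intro n
    induction n with
    | zero =>
      intro ω z _
      have h : HasDerivAt (wordMap F 0 ω) 1 z := hasDerivAt_id z
      exact ⟨h.differentiableAt, by simp [h.deriv]⟩
    | succ n ih =>
      intro ω z hz
      obtain ⟨h1, h2⟩ := ih (fun k => ω k.succ) z hz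
      have hz' := hmaps n (fun k => ω k.succ) hz
      have h3 := (hF (ω 0)).2.1.differentiableAt (hU.mem_nhds hz')
      have h := h3.hasDerivAt.comp z h1.hasDerivAt
      exact ⟨h.differentiableAt, by
        change deriv (F (ω 0) ∘ _) z ≠ 0
        rw [h.deriv]
        exact mul_ne_zero ((hF (ω 0)).2.2.1 _ hz') h2⟩
  have hext : ∀ (n : ℕ) (ω : Fin n → Fin d), ∀ x ∈ Φ.X,
      wordMap F n ω (x : ℂ) = ((wordMap Φ.map n ω x : ℝ) : ℂ) := by
    intro n
    induction n with
    | zero => exact fun _ _ _ => rfl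
    | succ n ih =>
      intro ω x hx
      change F (ω 0) (wordMap F n _ x) = _
      rw [ih _ x hx, (hF (ω 0)).2.2.2 _ (Φ.wordMap_mapsTo n _ hx)]
      rfl
  have hreal : ∀ (n : ℕ) (ω : Fin n → Fin d), ∀ p ∈ interior Φ.X,
      DifferentiableAt ℝ (wordMap Φ.map n ω) p ∧
        deriv (wordMap F n ω) p = (deriv (wordMap Φ.map n ω) p : ℝ) := fun n ω p hp =>
    hasDerivAt_of_complex_extension (hdiff n ω p (hXU p (interior_subset hp))).1
      (eventually_of_mem (isOpen_interior.mem_nhds hp) fun x hx =>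
        hext n ω x (interior_subset hx))
  have hnorm : ∀ (n : ℕ) (ω : Fin n → Fin d), ∀ p ∈ interior Φ.X,
      ‖deriv (wordMap F n ω) p‖ = |deriv (wordMap Φ.map n ω) p| := fun n ω p hp => by
    rw [(hreal n ω p hp).2, Complex.norm_real, Real.norm_eq_abs]
  refine ⟨fun n ω p hp => ⟨(hreal n ω p hp).1, fun h0 => ?_⟩, C, hC, fun n ω p hp q hq => ?_⟩
  · refine (hdiff n ω p (hXU p (interior_subset hp))).2 ?_
    rw [(hreal n ω p hp).2, h0, Complex.ofReal_zero]
  · rw [← hnorm n ω p hp, ← hnorm n ω q hq]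
    exact hD n ω q (hXU q (interior_subset hq)) p (hXU p (interior_subset hp))

theorem differentiableAt_map (Φ : ConformalIFS d) (i : Fin d) {p : ℝ} (hp : p ∈ interior Φ.X) :
    DifferentiableAt ℝ (Φ.map i) p ∧ deriv (Φ.map i) p ≠ 0 :=
  Φ.exists_distortion.1 1 (fun _ => i) p hp

/-- The Birkhoff sums of the geometric potential are the logarithms of the derivatives of the
compositions of generators. -/
theorem exp_birkhoffSum_potential (Φ : ConformalIFS d) (n : ℕ) (x : ℕ → Fin d) :
    Real.exp (birkhoffSum leftShift Φ.potential n x) =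
      |deriv (wordMap Φ.map n (fun k => x k)) (Φ.coding (leftShift^[n] x))| := by
  induction n generalizing x with
  | zero =>
    have h : HasDerivAt (wordMap Φ.map 0 (fun k : Fin 0 => x k)) 1
      (Φ.coding (leftShift^[0] x)) := hasDerivAt_id _
    rw [show deriv (wordMap Φ.map 0 (fun k : Fin 0 => x k)) (Φ.coding (leftShift^[0] x)) = 1
      from h.deriv]
    simp
  | succ n ih =>
    have hp := Φ.coding_mem_interior (leftShift^[n + 1] x)
    have h1 := (Φ.exists_distortion.1 n (fun k => leftShift x k) _ hp).1
    have h2 := Φ.differentiableAt_map (x 0) (Φ.coding_mem_interior (leftShift x))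
    have hw := Φ.wordMap_coding n (leftShift x)
    rw [← Function.iterate_succ_apply] at hw
    have h3 : HasDerivAt (Φ.map (x 0)) (deriv (Φ.map (x 0)) (Φ.coding (leftShift x)))
        (wordMap Φ.map n (fun k => leftShift x k) (Φ.coding (leftShift^[n + 1] x))) := by
      rw [hw]
      exact h2.1.hasDerivAt
    have h4 := h3.comp _ h1.hasDerivAt
    have h5 : deriv (wordMap Φ.map (n + 1) (fun k => x k)) (Φ.coding (leftShift^[n + 1] x)) =
      _ := h4.deriv
    rw [h5, abs_mul, birkhoffSum_succ', Real.exp_add, ih (leftShift x), potential,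
      Real.exp_log_eq_abs h2.2, Function.iterate_succ_apply]

/-- The mean value theorem for compositions of generators, in a form without an order on the two
points. -/
theorem exists_deriv_wordMap_eq (Φ : ConformalIFS d) (n : ℕ) (ω : Fin n → Fin d) {p q : ℝ}
    (hp : p ∈ interior Φ.X) (hq : q ∈ interior Φ.X) :
    ∃ ξ ∈ interior Φ.X,
      |wordMap Φ.map n ω p - wordMap Φ.map n ω q| = |deriv (wordMap Φ.map n ω) ξ| * |p - q| := by
  have hord : OrdConnected (interior Φ.X) :=
    (Φ.isConnected_X.isPreconnected.ordConnected.convex (𝕜 := ℝ)).interior.ordConnected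
  have key : ∀ {p q : ℝ}, p ∈ interior Φ.X → q ∈ interior Φ.X → p < q → ∃ ξ ∈ interior Φ.X,
      |wordMap Φ.map n ω p - wordMap Φ.map n ω q| =
        |deriv (wordMap Φ.map n ω) ξ| * |p - q| := by
    intro p q hp hq hpq
    have hsub : Icc p q ⊆ interior Φ.X := hord.out hp hq
    obtain ⟨ξ, hξ, he⟩ := exists_deriv_eq_slope (wordMap Φ.map n ω) hpq
      (fun z hz => ((Φ.exists_distortion.1 n ω z (hsub hz)).1).continuousAt.continuousWithinAt)
      (fun z hz => ((Φ.exists_distortion.1 n ω z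
        (hsub (Ioo_subset_Icc_self hz))).1).differentiableWithinAt)
    refine ⟨ξ, hsub (Ioo_subset_Icc_self hξ), ?_⟩
    rw [he, ← abs_mul, abs_sub_comm, ← abs_neg (_ * _)]
    congr 1
    have : q - p ≠ 0 := (sub_pos.2 hpq).ne'
    field_simp
    ring
  rcases lt_trichotomy p q with h | h | h
  · exact key hp hq h
  · exact ⟨p, hp, by simp [h]⟩
  · obtain ⟨ξ, h1, h2⟩ := key hq hp h
    exact ⟨ξ, h1, by rw [abs_sub_comm, h2, abs_sub_comm]⟩

/-- The coding map turns the shift space into a metric copy of the limit set: two points whose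
codes first differ at position `n` have distance comparable to `exp (S_n I_Φ)`. -/
theorem exists_dist_coding_comparable (Φ : ConformalIFS d) :
    ∃ C : ℝ, 1 ≤ C ∧
      (∀ (n : ℕ) (x y : ℕ → Fin d), (∀ k < n, x k = y k) →
        |Φ.coding x - Φ.coding y| ≤ C * Real.exp (birkhoffSum leftShift Φ.potential n x)) ∧
      ∀ (n : ℕ) (x y : ℕ → Fin d), (∀ k < n, x k = y k) → x n ≠ y n →
        C⁻¹ * Real.exp (birkhoffSum leftShift Φ.potential n x) ≤
          |Φ.coding x - Φ.coding y| := by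
  obtain ⟨hdiff, C, hC, hD⟩ := Φ.exists_distortion
  obtain ⟨δ, hδ, hsep⟩ := Φ.exists_separation
  obtain ⟨B, hB⟩ := Metric.isBounded_iff.1 Φ.isCompact_X.isBounded
  obtain ⟨p₀, hp₀⟩ := Φ.isConnected_X.nonempty
  have hB0 : 0 ≤ B := dist_nonneg.trans (hB hp₀ hp₀)
  have hC0 : 0 < C := one_pos.trans_le hC
  have hmvt : ∀ (n : ℕ) (x y : ℕ → Fin d), (∀ k < n, x k = y k) →
      ∃ ξ ∈ interior Φ.X, |Φ.coding x - Φ.coding y| =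
        |deriv (wordMap Φ.map n (fun k => x k)) ξ| *
          |Φ.coding (leftShift^[n] x) - Φ.coding (leftShift^[n] y)| := by
    intro n x y hxy
    obtain ⟨ξ, hξ, he⟩ := Φ.exists_deriv_wordMap_eq n (fun k => x k)
      (Φ.coding_mem_interior (leftShift^[n] x)) (Φ.coding_mem_interior (leftShift^[n] y))
    refine ⟨ξ, hξ, ?_⟩
    rw [← he, Φ.wordMap_coding n x, Φ.wordMap_congr hxy, Φ.wordMap_coding n y]
  refine ⟨max 1 (max (C * B) (C * δ⁻¹)), le_max_left _ _, fun n x y hxy => ?_,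
    fun n x y hxy hne => ?_⟩
  · obtain ⟨ξ, hξ, he⟩ := hmvt n x y hxy
    have h1 := hD n (fun k => x k) ξ hξ _ (Φ.coding_mem_interior (leftShift^[n] x))
    have h2 : |Φ.coding (leftShift^[n] x) - Φ.coding (leftShift^[n] y)| ≤ B :=
      hB (Φ.coding_mem_X _) (Φ.coding_mem_X _)
    rw [← exp_birkhoffSum_potential] at h1
    calc _ ≤ (C * Real.exp (birkhoffSum leftShift Φ.potential n x)) * B := by
          rw [he]
          exact mul_le_mul h1 h2 (abs_nonneg _) (by positivity)
      _ = (C * B) * Real.exp (birkhoffSum leftShift Φ.potential n x) := by ring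
      _ ≤ _ := mul_le_mul_of_nonneg_right
          ((le_max_left _ _).trans (le_max_right _ _)) (Real.exp_pos _).le
  · obtain ⟨ξ, hξ, he⟩ := hmvt n x y hxy
    have h1 := hD n (fun k => x k) _ (Φ.coding_mem_interior (leftShift^[n] x)) ξ hξ
    have h2 : δ ≤ |Φ.coding (leftShift^[n] x) - Φ.coding (leftShift^[n] y)| := by
      refine hsep _ _ ?_
      simpa [iterate_leftShift_apply] using hne
    rw [← exp_birkhoffSum_potential] at h1
    set E := Real.exp (birkhoffSum leftShift Φ.potential n x)
    have hE : 0 < E := Real.exp_pos _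
    have h3 : C * δ⁻¹ ≤ max 1 (max (C * B) (C * δ⁻¹)) :=
      (le_max_right _ _).trans (le_max_right _ _)
    calc _ ≤ (C * δ⁻¹)⁻¹ * E :=
          mul_le_mul_of_nonneg_right (inv_anti₀ (by positivity) h3) hE.le
      _ = C⁻¹ * E * δ := by rw [mul_inv, inv_inv]; ring
      _ ≤ |deriv (wordMap Φ.map n (fun k => x k)) ξ| *
          |Φ.coding (leftShift^[n] x) - Φ.coding (leftShift^[n] y)| := by
        refine mul_le_mul ?_ h2 hδ.le (abs_nonneg _)
        rw [inv_mul_le_iff₀ hC0]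
        exact h1
      _ = _ := he.symm

theorem coding_injective (Φ : ConformalIFS d) : Function.Injective Φ.coding := by
  intro x y hxy
  by_contra hne
  obtain ⟨C, hC, -, h⟩ := Φ.exists_dist_coding_comparable
  classical
  have hex : ∃ n, x n ≠ y n := Function.ne_iff.1 hne
  have h1 := h (Nat.find hex) x y
    (fun k hk => not_not.1 (Nat.find_min hex hk)) (Nat.find_spec hex)
  rw [hxy, sub_self, abs_zero] at h1
  have : 0 < C⁻¹ * Real.exp (birkhoffSum leftShift Φ.potential (Nat.find hex) x) := by positivity
  linarith

/-! ### Deformations and rates -/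

/-- If the Birkhoff sums of `Ψ` are dominated by those of `Φ`, then `π_Ψ ∘ π_Φ⁻¹` is Lipschitz. -/
theorem exists_dist_coding_le_of_birkhoffSum_le {Φ Ψ : ConformalIFS d} {K : ℝ}
    (hK : ∀ (n : ℕ) (x : ℕ → Fin d), birkhoffSum leftShift Ψ.potential n x ≤
      birkhoffSum leftShift Φ.potential n x + K) :
    ∃ L : ℝ, 1 ≤ L ∧ ∀ x y, |Ψ.coding x - Ψ.coding y| ≤ L * |Φ.coding x - Φ.coding y| := by
  obtain ⟨C, hC, -, hΦ⟩ := Φ.exists_dist_coding_comparable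
  obtain ⟨D, hD, hΨ, -⟩ := Ψ.exists_dist_coding_comparable
  refine ⟨max 1 (D * Real.exp K * C), le_max_left _ _, fun x y => ?_⟩
  by_cases hxy : x = y
  · simp [hxy]
  classical
  have hex : ∃ n, x n ≠ y n := Function.ne_iff.1 hxy
  have hag : ∀ k < Nat.find hex, x k = y k := fun k hk => not_not.1 (Nat.find_min hex hk)
  have h1 := hΦ _ x y hag (Nat.find_spec hex)
  have h2 := hΨ _ x y hag
  set n := Nat.find hex
  have hC0 : 0 < C := one_pos.trans_le hC
  have hD0 : 0 < D := one_pos.trans_le hD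
  rw [inv_mul_le_iff₀ hC0] at h1
  have h3 : Real.exp (birkhoffSum leftShift Ψ.potential n x) ≤
      Real.exp K * Real.exp (birkhoffSum leftShift Φ.potential n x) := by
    rw [← Real.exp_add]
    exact Real.exp_le_exp.2 (by linarith [hK n x])
  calc _ ≤ D * (Real.exp K * (C * |Φ.coding x - Φ.coding y|)) :=
        h2.trans (mul_le_mul_of_nonneg_left
          (h3.trans (mul_le_mul_of_nonneg_left h1 (Real.exp_pos _).le)) hD0.le)
    _ = (D * Real.exp K * C) * |Φ.coding x - Φ.coding y| := by ring
    _ ≤ _ := mul_le_mul_of_nonneg_right (le_max_right _ _) (abs_nonneg _)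

/-- If `π_Ψ ∘ π_Φ⁻¹` is Lipschitz, then the Birkhoff sums of `Ψ` are dominated by those of `Φ`. With
at least two symbols every `x` has a companion that first differs from it at a given position. -/
theorem exists_birkhoffSum_le_of_dist_coding_le [Nontrivial (Fin d)] {Φ Ψ : ConformalIFS d}
    {L : ℝ} (hL : 1 ≤ L)
    (h : ∀ x y, |Ψ.coding x - Ψ.coding y| ≤ L * |Φ.coding x - Φ.coding y|) :
    ∃ K : ℝ, 0 ≤ K ∧ ∀ (n : ℕ) (x : ℕ → Fin d), birkhoffSum leftShift Ψ.potential n x ≤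
      birkhoffSum leftShift Φ.potential n x + K := by
  obtain ⟨C, hC, hΦ, -⟩ := Φ.exists_dist_coding_comparable
  obtain ⟨D, hD, -, hΨ⟩ := Ψ.exists_dist_coding_comparable
  have hD0 : 0 < D := one_pos.trans_le hD
  have h1 : 1 ≤ D * L * C := one_le_mul_of_one_le_of_one_le
    (one_le_mul_of_one_le_of_one_le hD hL) hC
  refine ⟨Real.log (D * L * C), Real.log_nonneg h1, fun n x => ?_⟩
  obtain ⟨j, hj⟩ := exists_ne (x n)
  let y : ℕ → Fin d := Function.update x n j
  have hag : ∀ k < n, x k = y k := fun k hk => by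
    simp [y, Function.update_of_ne hk.ne]
  have h2 := hΨ n x y hag (by simpa [y] using hj.symm)
  have h3 := (h2.trans (h x y)).trans
    (mul_le_mul_of_nonneg_left (hΦ n x y hag) (zero_le_one.trans hL))
  rw [inv_mul_le_iff₀ hD0] at h3
  rw [← Real.exp_le_exp, Real.exp_add, Real.exp_log (by linarith)]
  linarith

/-- A system is a deformation of another one if and only if the Birkhoff sums of the two geometric
potentials stay at bounded distance from each other. -/
theorem isDeformation_iff_birkhoffSum_bounded [Nontrivial (Fin d)] (Φ Ψ : ConformalIFS d) :
    Φ.IsDeformation Ψ ↔ ∃ K : ℝ, ∀ (n : ℕ) (x : ℕ → Fin d),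
      |birkhoffSum leftShift Φ.potential n x - birkhoffSum leftShift Ψ.potential n x| ≤ K := by
  constructor
  · rintro ⟨h, hbij, ⟨L, hL, hlip⟩, hconj⟩
    rw [Φ.limitSet_eq_range_coding] at hlip hconj hbij
    have hword : ∀ (n : ℕ) (x : ℕ → Fin d), h (Φ.coding x) =
        wordMap Ψ.map n (fun k => x k) (h (Φ.coding (leftShift^[n] x))) := by
      intro n
      induction n with
      | zero => exact fun _ => rfl
      | succ n ih =>
        intro x
        rw [← Φ.map_coding x, hconj _ _ (mem_range_self _), ih (leftShift x)]
        rfl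
    -- A conjugacy respects codes, hence is `π_Ψ ∘ π_Φ⁻¹`.
    have hcod : ∀ x, Ψ.coding x = h (Φ.coding x) := fun x => Ψ.coding_eq fun n => by
      refine ⟨h (Φ.coding (leftShift^[n] x)), ?_, (hword n x).symm⟩
      have := hbij.mapsTo (mem_range_self (f := Φ.coding) (leftShift^[n] x))
      rw [Ψ.limitSet_eq_range_coding] at this
      obtain ⟨y, hy⟩ := this
      exact hy ▸ Ψ.coding_mem_X y
    obtain ⟨K, -, hK⟩ := exists_birkhoffSum_le_of_dist_coding_le (Φ := Φ) (Ψ := Ψ) hL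
      fun x y => by
        rw [hcod, hcod]
        exact (hlip _ (mem_range_self x) _ (mem_range_self y)).2
    obtain ⟨K', -, hK'⟩ := exists_birkhoffSum_le_of_dist_coding_le (Φ := Ψ) (Ψ := Φ) hL
      fun x y => by
        rw [hcod, hcod, ← inv_mul_le_iff₀ (one_pos.trans_le hL)]
        exact (hlip _ (mem_range_self x) _ (mem_range_self y)).1
    refine ⟨max K K', fun n x => abs_le.2 ⟨?_, ?_⟩⟩
    · linarith [hK n x, le_max_left K K']
    · linarith [hK' n x, le_max_right K K']
  · rintro ⟨K, hK⟩
    obtain ⟨L, hL, h1⟩ := exists_dist_coding_le_of_birkhoffSum_le (Φ := Φ) (Ψ := Ψ) (K := K)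
      fun n x => by linarith [(abs_le.1 (hK n x)).1]
    obtain ⟨L', hL', h2⟩ := exists_dist_coding_le_of_birkhoffSum_le (Φ := Ψ) (Ψ := Φ) (K := K)
      fun n x => by linarith [(abs_le.1 (hK n x)).2]
    let h : ℝ → ℝ := Ψ.coding ∘ Function.invFun Φ.coding
    have hh : ∀ x, h (Φ.coding x) = Ψ.coding x := fun x =>
      congrArg Ψ.coding (Function.leftInverse_invFun Φ.coding_injective x)
    refine ⟨h, ?_, ⟨max L L', hL.trans (le_max_left _ _), ?_⟩, ?_⟩
    · rw [Φ.limitSet_eq_range_coding, Ψ.limitSet_eq_range_coding]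
      refine ⟨?_, ?_, ?_⟩
      · rintro _ ⟨x, rfl⟩
        exact ⟨x, (hh x).symm⟩
      · rintro _ ⟨x, rfl⟩ _ ⟨y, rfl⟩ hxy
        rw [hh, hh] at hxy
        rw [Ψ.coding_injective hxy]
      · rintro _ ⟨x, rfl⟩
        exact ⟨_, mem_range_self x, hh x⟩
    · rw [Φ.limitSet_eq_range_coding]
      rintro _ ⟨x, rfl⟩ _ ⟨y, rfl⟩
      rw [hh, hh]
      refine ⟨?_, (h1 x y).trans (mul_le_mul_of_nonneg_right (le_max_left _ _) (abs_nonneg _))⟩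
      rw [inv_mul_le_iff₀ (by linarith [le_max_left L L'])]
      exact (h2 x y).trans (mul_le_mul_of_nonneg_right (le_max_right _ _) (abs_nonneg _))
    · rw [Φ.limitSet_eq_range_coding]
      rintro i _ ⟨x, rfl⟩
      -- the sequence `i x₀ x₁ ⋯`
      let z : ℕ → Fin d := fun n => Nat.casesOn n i x
      have hz : leftShift z = x := rfl
      have e1 := Φ.map_coding z
      have e2 := Ψ.map_coding z
      rw [hz] at e1 e2
      change Φ.map i _ = _ at e1
      change Ψ.map i _ = _ at e2
      rw [e1, hh, hh, e2]

/-- The numbers `r i > 0` are the logarithmic contraction rates of `Φ` if the Birkhoff sums of the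
geometric potential are, up to a bounded error, those of the function `x ↦ -r (x 0)`. -/
def HasRates (Φ : ConformalIFS d) (r : Fin d → ℝ) : Prop :=
  (∀ i, 0 < r i) ∧ ∃ K : ℝ, ∀ (n : ℕ) (x : ℕ → Fin d),
    |birkhoffSum leftShift Φ.potential n x + ∑ k ∈ Finset.range n, r (x k)| ≤ K

/-- The rates of an affine system are minus the logarithms of its contraction ratios. -/
theorem IsAffine.exists_hasRates [Nontrivial (Fin d)] {Θ : ConformalIFS d} (h : Θ.IsAffine) :
    ∃ r, Θ.HasRates r := by
  choose a b hab using h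
  obtain ⟨i₀⟩ : Nonempty (Fin d) := inferInstance
  have hderiv : ∀ i, ∀ p ∈ interior Θ.X, deriv (Θ.map i) p = a i := by
    intro i p hp
    have h1 : HasDerivAt (fun x => a i * x + b i) (a i) p := by
      simpa using ((hasDerivAt_id p).const_mul (a i)).add_const (b i)
    refine (h1.congr_of_eventuallyEq ?_).deriv
    exact eventually_of_mem (isOpen_interior.mem_nhds hp) fun x hx =>
      hab i x (interior_subset hx)
  have hp₀ := Θ.coding_mem_interior fun _ => i₀
  have ha0 : ∀ i, a i ≠ 0 := fun i => by
    rw [← hderiv i _ hp₀]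
    exact (Θ.differentiableAt_map i hp₀).2
  have ha1 : ∀ i, |a i| < 1 := by
    intro i
    obtain ⟨K, hK, hL⟩ := Θ.contraction i
    obtain ⟨j, hj⟩ := exists_ne i₀
    have hne : Θ.coding (fun _ => i₀) ≠ Θ.coding (fun _ => j) :=
      Θ.coding_ne_of_head_ne hj.symm
    have h1 := hL.dist_le_mul _ (Θ.coding_mem_X fun _ => i₀) _ (Θ.coding_mem_X fun _ => j)
    rw [hab i _ (Θ.coding_mem_X _), hab i _ (Θ.coding_mem_X _), Real.dist_eq, Real.dist_eq,
      show ∀ s t : ℝ, a i * s + b i - (a i * t + b i) = a i * (s - t) from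
        fun s t => by ring, abs_mul] at h1
    have h2 := le_of_mul_le_mul_right h1 (abs_pos.2 (sub_ne_zero.2 hne))
    exact h2.trans_lt (by exact_mod_cast hK)
  refine ⟨fun i => -Real.log (a i), fun i => ?_, 0, fun n x => ?_⟩
  · change 0 < -Real.log (a i)
    rw [← Real.log_abs]
    exact neg_pos.2 (Real.log_neg (abs_pos.2 (ha0 i)) (ha1 i))
  · have h1 : ∀ y, Θ.potential y = Real.log (a (y 0)) := fun y => by
      rw [potential, hderiv _ _ (Θ.coding_mem_interior _)]
    simp [birkhoffSum, h1, iterate_leftShift_apply]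

theorem HasRates.of_birkhoffSum_bounded {Φ Ψ : ConformalIFS d} {r : Fin d → ℝ}
    (h : Φ.HasRates r) {K : ℝ} (hK : ∀ (n : ℕ) (x : ℕ → Fin d),
      |birkhoffSum leftShift Φ.potential n x - birkhoffSum leftShift Ψ.potential n x| ≤ K) :
    Ψ.HasRates r := by
  obtain ⟨hr, K', h'⟩ := h
  refine ⟨hr, K + K', fun n x => ?_⟩
  rw [show birkhoffSum leftShift Ψ.potential n x + ∑ k ∈ Finset.range n, r (x k) =
    -(birkhoffSum leftShift Φ.potential n x - birkhoffSum leftShift Ψ.potential n x) +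
      (birkhoffSum leftShift Φ.potential n x + ∑ k ∈ Finset.range n, r (x k)) by ring]
  refine (abs_add_le _ _).trans (add_le_add ?_ (h' n x))
  rw [abs_neg]
  exact hK n x

theorem IsEssentiallyAffine.exists_hasRates [Nontrivial (Fin d)] {Φ : ConformalIFS d}
    (h : Φ.IsEssentiallyAffine) : ∃ r, Φ.HasRates r := by
  obtain ⟨Θ, hΘ, hdef⟩ := h
  obtain ⟨r, hr⟩ := hΘ.exists_hasRates
  obtain ⟨K, hK⟩ := (isDeformation_iff_birkhoffSum_bounded Θ Φ).1 hdef
  exact ⟨r, hr.of_birkhoffSum_bounded hK⟩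

/-- Systems with the same rates have Birkhoff sums at bounded distance from each other. -/
theorem HasRates.birkhoffSum_bounded {Φ Ψ : ConformalIFS d} {r : Fin d → ℝ}
    (hΦ : Φ.HasRates r) (hΨ : Ψ.HasRates r) : ∃ K : ℝ, ∀ (n : ℕ) (x : ℕ → Fin d),
      |birkhoffSum leftShift Φ.potential n x - birkhoffSum leftShift Ψ.potential n x| ≤ K := by
  obtain ⟨-, K, hK⟩ := hΦ
  obtain ⟨-, K', hK'⟩ := hΨ
  refine ⟨K + K', fun n x => ?_⟩
  rw [← add_sub_add_right_eq_sub _ _ (∑ k ∈ Finset.range n, r (x k))]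
  exact (abs_sub _ _).trans (add_le_add (hK n x) (hK' n x))

/-- A real number all of whose natural multiples are bounded vanishes. -/
theorem eq_zero_of_nat_mul_bounded {a K : ℝ} (h : ∀ n : ℕ, |n * a| ≤ K) : a = 0 := by
  by_contra ha
  obtain ⟨n, hn⟩ := exists_nat_gt (K / |a|)
  rw [div_lt_iff₀ (abs_pos.2 ha)] at hn
  have := h n
  rw [abs_mul, Nat.abs_cast] at this
  linarith

/-- Rates are detected on the constant sequences, hence determined by Birkhoff sums up to bounded
errors. -/
theorem HasRates.unique_of_birkhoffSum_bounded {Φ Ψ : ConformalIFS d} {r s : Fin d → ℝ}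
    (hΦ : Φ.HasRates r) (hΨ : Ψ.HasRates s) {K : ℝ} (hK : ∀ (n : ℕ) (x : ℕ → Fin d),
      |birkhoffSum leftShift Φ.potential n x - birkhoffSum leftShift Ψ.potential n x| ≤ K) :
    r = s := by
  obtain ⟨-, K₁, h₁⟩ := hΦ
  obtain ⟨-, K₂, h₂⟩ := hΨ
  funext i
  refine sub_eq_zero.1 (eq_zero_of_nat_mul_bounded (K := K₁ + K + K₂) fun n => ?_)
  have e1 := abs_le.1 (h₁ n fun _ => i)
  have e2 := abs_le.1 (h₂ n fun _ => i)
  have e3 := abs_le.1 (hK n fun _ => i)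
  simp only [Finset.sum_const, Finset.card_range, nsmul_eq_mul] at e1 e2
  rw [mul_sub]
  exact abs_le.2 ⟨by linarith, by linarith⟩

theorem coding_permute (Φ : ConformalIFS d) (τ : Equiv.Perm (Fin d)) (x : ℕ → Fin d) :
    (Φ.permute τ).coding x = Φ.coding (fun k => τ (x k)) := by
  refine (Φ.permute τ).coding_eq fun n => ?_
  have h := Φ.coding_mem (fun k => τ (x k)) n
  rwa [← wordMap_reindex Φ.map τ n (fun k => x k)] at h

theorem potential_permute (Φ : ConformalIFS d) (τ : Equiv.Perm (Fin d)) (x : ℕ → Fin d) :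
    (Φ.permute τ).potential x = Φ.potential (fun k => τ (x k)) := by
  simp only [potential, coding_permute]
  rfl

theorem iterate_leftShift_comp (τ : Equiv.Perm (Fin d)) (n : ℕ) (x : ℕ → Fin d) :
    (fun k => τ (leftShift^[n] x k)) = leftShift^[n] (fun k => τ (x k)) := by
  funext k
  simp only [iterate_leftShift_apply]

theorem birkhoffSum_potential_permute (Φ : ConformalIFS d) (τ : Equiv.Perm (Fin d)) (n : ℕ)
    (x : ℕ → Fin d) : birkhoffSum leftShift (Φ.permute τ).potential n x =
      birkhoffSum leftShift Φ.potential n (fun k => τ (x k)) := by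
  simp only [birkhoffSum, potential_permute, iterate_leftShift_comp]

theorem HasRates.permute {Φ : ConformalIFS d} {r : Fin d → ℝ} (h : Φ.HasRates r)
    (τ : Equiv.Perm (Fin d)) : (Φ.permute τ).HasRates (r ∘ τ) := by
  obtain ⟨hr, K, hK⟩ := h
  refine ⟨fun i => hr _, K, fun n x => ?_⟩
  rw [birkhoffSum_potential_permute]
  exact hK n fun k => τ (x k)

/-! ### Livsic's theorem and cohomology of geometric potentials -/

theorem continuous_leftShift : Continuous (leftShift : (ℕ → Fin d) → ℕ → Fin d) :=
  continuous_pi fun n => continuous_apply (n + 1)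

/-- The sequence `a ⋯ a x₀ x₁ ⋯` with `n` symbols `a` in front of `x`. -/
def prependConst (a : Fin d) (n : ℕ) (x : ℕ → Fin d) : ℕ → Fin d :=
  fun k => if k < n then a else x (k - n)

theorem leftShift_prependConst (a : Fin d) (n : ℕ) (x : ℕ → Fin d) :
    leftShift (prependConst a (n + 1) x) = prependConst a n x := by
  funext k
  simp [leftShift, prependConst]

theorem iterate_leftShift_prependConst (a : Fin d) (n : ℕ) (x : ℕ → Fin d) :
    leftShift^[n] (prependConst a n x) = x := by
  funext k
  simp [iterate_leftShift_apply, prependConst]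

theorem continuous_prependConst (a : Fin d) (n : ℕ) :
    Continuous (prependConst a n : (ℕ → Fin d) → ℕ → Fin d) := by
  refine continuous_pi fun k => ?_
  unfold prependConst
  split_ifs
  · exact continuous_const
  · exact continuous_apply _

theorem birkhoffSum_prependConst (g : (ℕ → Fin d) → ℝ) (a : Fin d) (n : ℕ) (x : ℕ → Fin d) :
    birkhoffSum leftShift g n (prependConst a n x) =
      ∑ k ∈ Finset.range n, g (prependConst a (k + 1) x) := by
  induction n with
  | zero => simp
  | succ n ih =>
    rw [birkhoffSum_succ', leftShift_prependConst, ih, Finset.sum_range_succ, add_comm]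

/-- For an exponentially regular function, Birkhoff sums of length `q` along sequences agreeing on
`q + N` symbols differ by an exponentially small quantity in `N`. -/
theorem abs_birkhoffSum_sub_le {g : (ℕ → Fin d) → ℝ} {θ B : ℝ} (hθ0 : 0 ≤ θ) (hθ1 : θ < 1)
    (hB : 0 ≤ B) (hg : ∀ (n : ℕ) (x y : ℕ → Fin d), (∀ k < n + 1, x k = y k) →
      |g x - g y| ≤ B * θ ^ n) (q N : ℕ) {x y : ℕ → Fin d} (hxy : ∀ k < q + N, x k = y k) :
    |birkhoffSum leftShift g q x - birkhoffSum leftShift g q y| ≤ B * (1 - θ)⁻¹ * θ ^ N := by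
  have key : ∀ (q : ℕ) (x y : ℕ → Fin d), (∀ k < q + N, x k = y k) →
      |birkhoffSum leftShift g q x - birkhoffSum leftShift g q y| ≤
        B * θ ^ N * ∑ j ∈ Finset.range q, θ ^ j := by
    intro q
    induction q with
    | zero => intro x y _; simp
    | succ q ih =>
      intro x y hxy
      rw [birkhoffSum_succ', birkhoffSum_succ', add_sub_add_comm, Finset.sum_range_succ]
      have h1 := hg (q + N) x y fun k hk => hxy k (by omega)
      have h2 := ih (leftShift x) (leftShift y) fun k hk => hxy (k + 1) (by omega)
      refine (abs_add_le _ _).trans ((add_le_add h1 h2).trans (le_of_eq ?_))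
      rw [pow_add]
      ring
  refine (key q x y hxy).trans ?_
  have h1 : ∑ j ∈ Finset.range q, θ ^ j ≤ (1 - θ)⁻¹ := by
    rw [← tsum_geometric_of_lt_one hθ0 hθ1]
    exact (summable_geometric_of_lt_one hθ0 hθ1).sum_le_tsum _ fun j _ => pow_nonneg hθ0 j
  calc _ ≤ B * θ ^ N * (1 - θ)⁻¹ := mul_le_mul_of_nonneg_left h1 (by positivity)
    _ = _ := by ring

theorem birkhoffSum_eq_zero_of_periodic {g : (ℕ → Fin d) → ℝ} {K : ℝ}
    (hK : ∀ (n : ℕ) (x : ℕ → Fin d), |birkhoffSum leftShift g n x| ≤ K) {q : ℕ} {p : ℕ → Fin d}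
    (hp : leftShift^[q] p = p) : birkhoffSum leftShift g q p = 0 := by
  refine eq_zero_of_nat_mul_bounded (K := K) fun n => ?_
  have h : birkhoffSum leftShift g (n * q) p = n * birkhoffSum leftShift g q p := by
    induction n with
    | zero => simp
    | succ n ih =>
      rw [Nat.succ_mul, Nat.add_comm, birkhoffSum_add, hp, ih]
      push_cast
      ring
  exact h ▸ hK (n * q) p

/-- Livsic's theorem on the full shift: an exponentially regular function with bounded Birkhoff
sums is a continuous coboundary. With a symbol `a` fixed, the transfer function is
`e x = -∑ g (aᵏ x)` (sum over `k ≥ 1`). On the dense set of sequences ending in `a a a ⋯` it equals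
a Birkhoff sum of `g`, by comparison with a periodic orbit, and there the coboundary equation is
immediate. -/
theorem exists_coboundary_of_birkhoffSum_bounded {g : (ℕ → Fin d) → ℝ} {θ B K : ℝ}
    (hθ0 : 0 ≤ θ) (hθ1 : θ < 1) (hB : 0 ≤ B)
    (hg : ∀ (n : ℕ) (x y : ℕ → Fin d), (∀ k < n + 1, x k = y k) → |g x - g y| ≤ B * θ ^ n)
    (hK : ∀ (n : ℕ) (x : ℕ → Fin d), |birkhoffSum leftShift g n x| ≤ K) :
    ∃ e : (ℕ → Fin d) → ℝ, Continuous e ∧ ∀ x, g x = e x - e (leftShift x) := by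
  rcases isEmpty_or_nonempty (Fin d) with hemp | ⟨⟨a⟩⟩
  · exact ⟨0, continuous_zero, fun x => (hemp.false (x 0)).elim⟩
  have hgc : Continuous g := by
    refine continuous_of_agree (b := fun n => B * θ ^ n) ?_ hg
    simpa using (tendsto_pow_atTop_nhds_zero_of_lt_one hθ0 hθ1).const_mul B
  have hga : g (fun _ => a) = 0 := by
    have h := birkhoffSum_eq_zero_of_periodic hK (q := 1) (p := fun _ => a) rfl
    rwa [birkhoffSum_one] at h
  have hbound : ∀ (n : ℕ) (x : ℕ → Fin d), ‖g (prependConst a (n + 1) x)‖ ≤ B * θ ^ n := by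
    intro n x
    have h := hg n (prependConst a (n + 1) x) (fun _ => a) fun k hk => by
      simp [prependConst, hk]
    rwa [hga, sub_zero] at h
  have hsumm : Summable fun n : ℕ => B * θ ^ n :=
    (summable_geometric_of_lt_one hθ0 hθ1).mul_left B
  let e : (ℕ → Fin d) → ℝ := fun x => -∑' n : ℕ, g (prependConst a (n + 1) x)
  have hec : Continuous e := (continuous_tsum
    (fun n => hgc.comp (continuous_prependConst a (n + 1))) hsumm hbound).neg
  have hlim : ∀ x, Tendsto (fun N => birkhoffSum leftShift g N (prependConst a N x)) atTop
      (𝓝 (-e x)) := by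
    intro x
    simp only [birkhoffSum_prependConst, e, neg_neg]
    exact (Summable.of_norm_bounded hsumm fun n => hbound n x).hasSum.tendsto_sum_nat
  have hend : ∀ (m : ℕ) (x : ℕ → Fin d), leftShift^[m] x = (fun _ => a) →
      e x = birkhoffSum leftShift g m x := by
    intro m x hx
    have hxa : ∀ k, m ≤ k → x k = a := fun k hk => by
      have h := congrFun hx (k - m)
      rwa [iterate_leftShift_apply, Nat.sub_add_cancel hk] at h
    have hsplit : ∀ N, birkhoffSum leftShift g (N + m) (prependConst a N x) =
        birkhoffSum leftShift g N (prependConst a N x) + birkhoffSum leftShift g m x := by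
      intro N
      rw [birkhoffSum_add, iterate_leftShift_prependConst]
    have hsmall : ∀ N, |birkhoffSum leftShift g (N + m) (prependConst a N x)| ≤
        B * (1 - θ)⁻¹ * θ ^ N := by
      intro N
      set z := prependConst a N x with hz
      -- `z = aᴺ x₀ ⋯ x_{m-1} a a a ⋯` shadows the periodic sequence with period `aᴺ x₀ ⋯ x_{m-1}`.
      let p : ℕ → Fin d := fun k => z (k % (N + m))
      have hp : leftShift^[N + m] p = p := by
        funext k
        simp only [iterate_leftShift_apply, p, Nat.add_mod_right]
      have hag : ∀ k < N + m + N, z k = p k := by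
        intro k hk
        by_cases hkq : k < N + m
        · simp only [p, Nat.mod_eq_of_lt hkq]
        · obtain ⟨l, rfl⟩ := Nat.exists_eq_add_of_le (not_lt.1 hkq)
          have hl : l < N := by omega
          simp only [p, Nat.add_mod_left, Nat.mod_eq_of_lt (show l < N + m by omega), hz,
            prependConst, if_pos hl]
          rw [if_neg (by omega)]
          exact hxa _ (by omega)
      have h := abs_birkhoffSum_sub_le hθ0 hθ1 hB hg (N + m) N hag
      rwa [birkhoffSum_eq_zero_of_periodic hK hp, sub_zero] at h
    have h0 : Tendsto (fun N => birkhoffSum leftShift g (N + m) (prependConst a N x)) atTop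
        (𝓝 0) := by
      refine squeeze_zero_norm hsmall ?_
      simpa using (tendsto_pow_atTop_nhds_zero_of_lt_one hθ0 hθ1).const_mul (B * (1 - θ)⁻¹)
    simp only [hsplit] at h0
    have h1 := tendsto_nhds_unique h0 ((hlim x).add_const (birkhoffSum leftShift g m x))
    linarith
  refine ⟨e, hec, fun x => ?_⟩
  -- Approximate `x` by sequences ending in `a a a ⋯`.
  let y : ℕ → ℕ → Fin d := fun m k => if k < m + 1 then x k else a
  have hy : Tendsto y atTop (𝓝 x) := by
    refine tendsto_pi_nhds.2 fun k => tendsto_const_nhds.congr' ?_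
    filter_upwards [eventually_ge_atTop k] with m hm
    exact (if_pos (Nat.lt_succ_of_le hm)).symm
  have heq : ∀ m, g (y m) = e (y m) - e (leftShift (y m)) := by
    intro m
    have hm : leftShift^[m + 1] (y m) = fun _ => a := by
      funext k
      simp only [iterate_leftShift_apply, y]
      rw [if_neg (by omega)]
    rw [hend (m + 1) (y m) hm, hend m (leftShift (y m)) hm, birkhoffSum_succ']
    ring
  have h1 : Tendsto (fun m => g (y m)) atTop (𝓝 (g x)) := (hgc.tendsto x).comp hy
  have h2 : Tendsto (fun m => e (y m) - e (leftShift (y m))) atTop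
      (𝓝 (e x - e (leftShift x))) :=
    ((hec.tendsto x).comp hy).sub (((hec.comp continuous_leftShift).tendsto x).comp hy)
  simp only [← heq] at h2
  exact tendsto_nhds_unique h1 h2

theorem birkhoffSum_coboundary (e : (ℕ → Fin d) → ℝ) (n : ℕ) (x : ℕ → Fin d) :
    birkhoffSum leftShift (fun y => e y - e (leftShift y)) n x = e x - e (leftShift^[n] x) := by
  induction n generalizing x with
  | zero => simp
  | succ n ih => rw [birkhoffSum_succ', ih, Function.iterate_succ_apply]; ring

theorem birkhoffSum_sub_apply (f g : (ℕ → Fin d) → ℝ) (n : ℕ) (x : ℕ → Fin d) :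
    birkhoffSum leftShift (fun y => f y - g y) n x =
      birkhoffSum leftShift f n x - birkhoffSum leftShift g n x := by
  simp [birkhoffSum]

theorem contDiffAt_log_deriv_map (Φ : ConformalIFS d) (i : Fin d) {p : ℝ}
    (hp : p ∈ interior Φ.X) : ContDiffAt ℝ 1 (fun x => Real.log (deriv (Φ.map i) x)) p := by
  refine ContDiffAt.log ?_ (Φ.differentiableAt_map i hp).2
  obtain ⟨U, F, hU, -, hXU, hF, -⟩ := Φ.conformal
  have hpU : (p : ℂ) ∈ U := hXU p (interior_subset hp)
  have hF' : ContDiffAt ℂ 1 (deriv (F i)) p :=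
    (((hF i).2.1.analyticAt (hU.mem_nhds hpU)).deriv).contDiffAt
  refine hF'.real_of_complex.congr_of_eventuallyEq ?_
  filter_upwards [isOpen_interior.mem_nhds hp] with x hx
  have h := (hasDerivAt_of_complex_extension
    ((hF i).2.1.differentiableAt (hU.mem_nhds (hXU x (interior_subset hx))))
    (eventually_of_mem (isOpen_interior.mem_nhds hx) fun y hy =>
      (hF i).2.2.2 y (interior_subset hy))).2
  rw [h, Complex.ofReal_re]

/-- The geometric potential is Hölder continuous for the standard metrics of the shift space. -/
theorem exists_abs_potential_sub_le (Φ : ConformalIFS d) [Nonempty (Fin d)] :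
    ∃ θ B : ℝ, 0 ≤ θ ∧ θ < 1 ∧ 0 ≤ B ∧ ∀ (n : ℕ) (x y : ℕ → Fin d),
      (∀ k < n + 1, x k = y k) → |Φ.potential x - Φ.potential y| ≤ B * θ ^ n := by
  obtain ⟨θ, B, h0, h1, hB, -, h⟩ := Φ.exists_dist_coding_le
  have hlip : ∀ i, ∃ M, LipschitzOnWith M (fun p => Real.log (deriv (Φ.map i) p))
      (range Φ.coding) := by
    intro i
    refine LocallyLipschitzOn.exists_lipschitzOnWith_of_compact
      (isCompact_range Φ.continuous_coding) ?_
    refine LocallyLipschitzOn.mono (t := interior Φ.X) ?_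
      (range_subset_iff.2 Φ.coding_mem_interior)
    exact ContDiffOn.locallyLipschitzOn
      (Φ.isConnected_X.isPreconnected.ordConnected.convex (𝕜 := ℝ)).interior
      fun p hp => (Φ.contDiffAt_log_deriv_map i hp).contDiffWithinAt
  choose M hM using hlip
  refine ⟨θ, (∑ i, (M i : ℝ)) * B, h0, h1, by positivity, fun n x y hxy => ?_⟩
  have h2 : |Φ.potential x - Φ.potential y| ≤
      M (x 0) * |Φ.coding (leftShift x) - Φ.coding (leftShift y)| := by
    have h3 := (hM (x 0)).dist_le_mul _ (mem_range_self (leftShift x)) _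
      (mem_range_self (leftShift y))
    rw [Real.dist_eq, Real.dist_eq] at h3
    unfold potential
    rwa [← hxy 0 n.succ_pos]
  have h4 : (M (x 0) : ℝ) ≤ ∑ i, (M i : ℝ) :=
    Finset.single_le_sum (f := fun i => (M i : ℝ)) (fun i _ => (M i).coe_nonneg)
      (Finset.mem_univ _)
  have h5 := h n (leftShift x) (leftShift y) fun k hk => hxy (k + 1) (by omega)
  rw [mul_assoc]
  exact h2.trans (mul_le_mul h4 h5 (abs_nonneg _) (by positivity))

/-- Geometric potentials are cohomologous if and only if their Birkhoff sums stay at bounded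
distance from each other. -/
theorem isCohomologous_potential_iff_birkhoffSum_bounded [Nonempty (Fin d)]
    (Φ Ψ : ConformalIFS d) :
    IsCohomologous Φ.potential Ψ.potential ↔ ∃ K : ℝ, ∀ (n : ℕ) (x : ℕ → Fin d),
      |birkhoffSum leftShift Φ.potential n x - birkhoffSum leftShift Ψ.potential n x| ≤ K := by
  constructor
  · rintro ⟨e, he, heq⟩
    obtain ⟨C, hC⟩ := (isCompact_range he).isBounded.exists_norm_le
    refine ⟨C + C, fun n x => ?_⟩
    rw [← birkhoffSum_sub_apply, funext heq, birkhoffSum_coboundary]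
    exact (abs_sub _ _).trans
      (add_le_add (hC _ (mem_range_self _)) (hC _ (mem_range_self _)))
  · rintro ⟨K, hK⟩
    obtain ⟨θ, B, h0, h1, hB, h⟩ := Φ.exists_abs_potential_sub_le
    obtain ⟨θ', B', h0', h1', hB', h'⟩ := Ψ.exists_abs_potential_sub_le
    have hb : ∀ n, B * θ ^ n + B' * θ' ^ n ≤ (B + B') * max θ θ' ^ n := fun n => by
      rw [add_mul]
      exact add_le_add
        (mul_le_mul_of_nonneg_left (pow_le_pow_left₀ h0 (le_max_left _ _) n) hB)
        (mul_le_mul_of_nonneg_left (pow_le_pow_left₀ h0' (le_max_right _ _) n) hB')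
    refine exists_coboundary_of_birkhoffSum_bounded (B := B + B')
      (h0.trans (le_max_left θ θ')) (max_lt h1 h1') (add_nonneg hB hB') (K := K)
      (fun n x y hxy => ?_) fun n x => ?_
    · refine le_trans ?_ (hb n)
      rw [sub_sub_sub_comm]
      exact (abs_sub _ _).trans (add_le_add (h n x y hxy) (h' n x y hxy))
    · rw [birkhoffSum_sub_apply]
      exact hK n x

/-! ### Pressure and Gibbs measures -/

theorem mem_cylinderSet_iff {n : ℕ} {ω : Fin n → Fin d} {x : ℕ → Fin d} :
    x ∈ cylinderSet ω ↔ (fun k : Fin n => x k) = ω :=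
  funext_iff.symm

theorem cylinderSet_nonempty [Nonempty (Fin d)] {n : ℕ} (ω : Fin n → Fin d) :
    (cylinderSet ω).Nonempty := by
  obtain ⟨i⟩ := ‹Nonempty (Fin d)›
  exact ⟨fun k => if hk : k < n then ω ⟨k, hk⟩ else i, fun k => by simp⟩

/-- The pressure of a potential that agrees, up to bounded errors of the Birkhoff sums, with a
function of the first symbol. -/
theorem topPressure_eq_log_sum_exp [Nonempty (Fin d)] {f : (ℕ → Fin d) → ℝ} {g : Fin d → ℝ}
    {K : ℝ} (hK : ∀ (n : ℕ) (x : ℕ → Fin d),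
      |birkhoffSum leftShift f n x - ∑ k ∈ Finset.range n, g (x k)| ≤ K) :
    topPressure f = Real.log (∑ i, Real.exp (g i)) := by
  set S := ∑ i, Real.exp (g i) with hS
  have hS0 : 0 < S := Finset.sum_pos (fun i _ => Real.exp_pos _) Finset.univ_nonempty
  have hpow : ∀ n : ℕ, ∑ ω : Fin n → Fin d, Real.exp (∑ k, g (ω k)) = S ^ n := fun n => by
    rw [hS, Fintype.sum_pow]
    exact Finset.sum_congr rfl fun ω _ => Real.exp_sum _ _
  have hsup : ∀ (n : ℕ) (ω : Fin n → Fin d),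
      |sSup (birkhoffSum leftShift f n '' cylinderSet ω) - ∑ k, g (ω k)| ≤ K := by
    intro n ω
    have hx : ∀ x ∈ cylinderSet ω, |birkhoffSum leftShift f n x - ∑ k, g (ω k)| ≤ K := by
      intro x hx
      rw [← mem_cylinderSet_iff.1 hx, Fin.sum_univ_eq_sum_range (fun k => g (x k))]
      exact hK n x
    obtain ⟨x, hxω⟩ := cylinderSet_nonempty ω
    have hub : ∀ y ∈ birkhoffSum leftShift f n '' cylinderSet ω, y ≤ ∑ k, g (ω k) + K := by
      rintro _ ⟨y, hy, rfl⟩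
      linarith [(abs_le.1 (hx y hy)).2]
    have h1 := le_csSup ⟨_, hub⟩ (mem_image_of_mem _ hxω)
    have h2 := csSup_le ⟨_, mem_image_of_mem _ hxω⟩ hub
    have h3 := (abs_le.1 (hx x hxω)).1
    exact abs_le.2 ⟨by linarith, by linarith⟩
  have hlog : ∀ n : ℕ, |Real.log (∑ ω : Fin n → Fin d,
      Real.exp (sSup (birkhoffSum leftShift f n '' cylinderSet ω))) - n * Real.log S| ≤ K := by
    intro n
    have hZ1 : ∑ ω : Fin n → Fin d,
        Real.exp (sSup (birkhoffSum leftShift f n '' cylinderSet ω)) ≤ Real.exp K * S ^ n := by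
      rw [← hpow, Finset.mul_sum]
      refine Finset.sum_le_sum fun ω _ => ?_
      rw [← Real.exp_add]
      exact Real.exp_le_exp.2 (by linarith [(abs_le.1 (hsup n ω)).2])
    have hZ2 : Real.exp (-K) * S ^ n ≤ ∑ ω : Fin n → Fin d,
        Real.exp (sSup (birkhoffSum leftShift f n '' cylinderSet ω)) := by
      rw [← hpow, Finset.mul_sum]
      refine Finset.sum_le_sum fun ω _ => ?_
      rw [← Real.exp_add]
      exact Real.exp_le_exp.2 (by linarith [(abs_le.1 (hsup n ω)).1])
    have hpos : 0 < Real.exp (-K) * S ^ n := by positivity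
    have h1 := Real.log_le_log (hpos.trans_le hZ2) hZ1
    have h2 := Real.log_le_log hpos hZ2
    rw [Real.log_mul (Real.exp_pos _).ne' (by positivity), Real.log_exp, Real.log_pow] at h1 h2
    exact abs_le.2 ⟨by linarith, by linarith⟩
  refine Tendsto.limUnder_eq (tendsto_iff_norm_sub_tendsto_zero.2 ?_)
  refine squeeze_zero' (Eventually.of_forall fun n => norm_nonneg _)
    (g := fun n : ℕ => K * (1 / (n : ℝ))) ?_ ?_
  · filter_upwards [eventually_gt_atTop 0] with n hn
    have hn0 : (0 : ℝ) < n := by exact_mod_cast hn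
    rw [show Real.log S = (1 / (n : ℝ)) * (n * Real.log S) by field_simp, ← mul_sub,
      Real.norm_eq_abs, abs_mul, abs_of_pos (by positivity : 0 < 1 / (n : ℝ)), mul_comm]
    exact mul_le_mul_of_nonneg_right (hlog n) (by positivity)
  · simpa using tendsto_one_div_atTop_nhds_zero_nat.const_mul K

theorem HasRates.abs_mul_birkhoffSum_add_le {Φ : ConformalIFS d} {r : Fin d → ℝ}
    (h : Φ.HasRates r) (u : ℝ) : ∃ K : ℝ, 0 ≤ K ∧ ∀ (n : ℕ) (x : ℕ → Fin d),
      |u * birkhoffSum leftShift Φ.potential n x + u * ∑ k ∈ Finset.range n, r (x k)| ≤ K := by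
  obtain ⟨-, K, hK⟩ := h
  refine ⟨|u| * |K|, by positivity, fun n x => ?_⟩
  rw [← mul_add, abs_mul]
  exact mul_le_mul_of_nonneg_left ((hK n x).trans (le_abs_self K)) (abs_nonneg u)

theorem HasRates.pressure_eq [Nonempty (Fin d)] {Φ : ConformalIFS d} {r : Fin d → ℝ}
    (h : Φ.HasRates r) (u : ℝ) :
    Φ.pressure u = Real.log (∑ i, Real.exp (-(u * r i))) := by
  obtain ⟨K, -, hK⟩ := h.abs_mul_birkhoffSum_add_le u
  refine topPressure_eq_log_sum_exp (K := K) fun n x => ?_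
  have h1 : birkhoffSum leftShift (fun x => u * Φ.potential x) n x =
      u * birkhoffSum leftShift Φ.potential n x := by
    simp [birkhoffSum, Finset.mul_sum]
  rw [h1, Finset.sum_neg_distrib, sub_neg_eq_add, ← Finset.mul_sum]
  exact hK n x

/-- Finite families of real numbers with equal power sums coincide up to a permutation. -/
theorem exists_perm_of_sum_pow_eq {ι : Type*} [Fintype ι] {a b : ι → ℝ}
    (h : ∀ n : ℕ, ∑ i, a i ^ n = ∑ i, b i ^ n) : ∃ τ : Equiv.Perm ι, a = b ∘ τ := by
  classical
  have hpoly : ∀ p : Polynomial ℝ, ∑ i, p.eval (a i) = ∑ i, p.eval (b i) := by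
    intro p
    simp only [Polynomial.eval_eq_sum_range]
    rw [Finset.sum_comm, Finset.sum_comm (s := Finset.univ)]
    simp only [← Finset.mul_sum, h]
  -- The Lagrange basis polynomial of a node counts how often this node occurs in a family.
  have hcard : ∀ c : ℝ, (Finset.univ.filter fun i => a i = c).card =
      (Finset.univ.filter fun i => b i = c).card := by
    intro c
    let T : Finset ℝ := insert c (Finset.univ.image a ∪ Finset.univ.image b)
    have hev : ∀ t ∈ T, (Lagrange.basis T id c).eval t = if t = c then 1 else 0 := by
      intro t ht
      split_ifs with htc
      · rw [htc]
        exact Lagrange.eval_basis_self (v := id) (injOn_id _) (Finset.mem_insert_self _ _)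
      · exact Lagrange.eval_basis_of_ne (v := id) (Ne.symm htc) ht
    have h1 := hpoly (Lagrange.basis T id c)
    rw [Finset.sum_congr rfl fun i _ => hev (a i) (by simp [T]),
      Finset.sum_congr rfl fun i _ => hev (b i) (by simp [T]), Finset.sum_boole,
      Finset.sum_boole] at h1
    exact_mod_cast h1
  have hequiv : ∀ c : ℝ, Nonempty ({i // a i = c} ≃ {i // b i = c}) := fun c => by
    refine ⟨Fintype.equivOfCardEq ?_⟩
    rw [Fintype.card_subtype, Fintype.card_subtype]
    exact hcard c
  refine ⟨Equiv.ofFiberEquiv fun c => (hequiv c).some, funext fun i => ?_⟩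
  exact (Equiv.ofFiberEquiv_map _ i).symm

/-- The pressure function determines the rates up to a permutation. -/
theorem HasRates.exists_perm_of_pressure_eq [Nonempty (Fin d)] {Φ Ψ : ConformalIFS d}
    {r s : Fin d → ℝ} (hΦ : Φ.HasRates r) (hΨ : Ψ.HasRates s) (h : Φ.pressure = Ψ.pressure) :
    ∃ τ : Equiv.Perm (Fin d), r = s ∘ τ := by
  obtain ⟨τ, hτ⟩ := exists_perm_of_sum_pow_eq (a := fun i => Real.exp (-r i))
    (b := fun i => Real.exp (-s i)) fun n => by
      -- The pressure at `u = n` is the logarithm of the `n`-th power sum.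
      have h1 := congrFun h n
      rw [hΦ.pressure_eq, hΨ.pressure_eq] at h1
      have h2 := Real.log_injOn_pos
        (Finset.sum_pos (fun i _ => Real.exp_pos _) Finset.univ_nonempty)
        (Finset.sum_pos (fun i _ => Real.exp_pos _) Finset.univ_nonempty) h1
      simpa only [← Real.exp_nat_mul, mul_neg] using h2
  refine ⟨τ, funext fun i => ?_⟩
  have := Real.exp_injective (congrFun hτ i)
  exact neg_injective this

theorem pressure_permute [Nonempty (Fin d)] {Φ : ConformalIFS d} {r : Fin d → ℝ}
    (h : Φ.HasRates r) (τ : Equiv.Perm (Fin d)) : (Φ.permute τ).pressure = Φ.pressure := by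
  funext u
  rw [(h.permute τ).pressure_eq, h.pressure_eq]
  exact congrArg Real.log (Equiv.sum_comp τ fun i => Real.exp (-(u * r i)))

/-- The probability weights `exp (-(u * r i)) / ∑ j, exp (-(u * r j))`. -/
noncomputable def gibbsWeights [Nonempty (Fin d)] (r : Fin d → ℝ) (u : ℝ) : PMF (Fin d) :=
  PMF.ofFintype (fun i => ENNReal.ofReal
      (Real.exp (-(u * r i) - Real.log (∑ j, Real.exp (-(u * r j)))))) <| by
    have hpos : 0 < ∑ j, Real.exp (-(u * r j)) :=
      Finset.sum_pos (fun i _ => Real.exp_pos _) Finset.univ_nonempty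
    rw [← ENNReal.ofReal_sum_of_nonneg fun i _ => (Real.exp_pos _).le]
    simp only [Real.exp_sub, Real.exp_log hpos, ← Finset.sum_div]
    rw [div_self hpos.ne', ENNReal.ofReal_one]

theorem gibbsWeights_apply [Nonempty (Fin d)] (r : Fin d → ℝ) (u : ℝ) (i : Fin d) :
    gibbsWeights r u i = ENNReal.ofReal
      (Real.exp (-(u * r i) - Real.log (∑ j, Real.exp (-(u * r j))))) :=
  PMF.ofFintype_apply _ _

/-- The Bernoulli measure on the full shift with the given weights. -/
noncomputable def bernoulliMeasure (p : PMF (Fin d)) : Measure (ℕ → Fin d) :=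
  Measure.infinitePi fun _ => p.toMeasure

instance (p : PMF (Fin d)) : IsProbabilityMeasure (bernoulliMeasure p) := by
  unfold bernoulliMeasure
  infer_instance

theorem measurable_leftShift : Measurable (leftShift : (ℕ → Fin d) → ℕ → Fin d) :=
  measurable_pi_lambda _ fun n => measurable_pi_apply (n + 1)

theorem measurePreserving_leftShift (p : PMF (Fin d)) :
    MeasurePreserving leftShift (bernoulliMeasure p) (bernoulliMeasure p) := by
  refine ⟨measurable_leftShift, Measure.eq_infinitePi _ fun s t ht => ?_⟩
  rw [Measure.map_apply measurable_leftShift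
    (MeasurableSet.pi s.countable_toSet fun i _ => ht i)]
  have h : leftShift ⁻¹' (s : Set ℕ).pi t =
      ((s.map (addRightEmbedding 1) : Finset ℕ) : Set ℕ).pi fun k => t (k - 1) := by
    ext x
    simp [Set.mem_pi, leftShift]
  rw [h, bernoulliMeasure, Measure.infinitePi_pi _ fun k _ => ht (k - 1)]
  simp

theorem bernoulliMeasure_cylinderSet (p : PMF (Fin d)) (n : ℕ) (x : ℕ → Fin d) :
    bernoulliMeasure p (cylinderSet fun k : Fin n => x k) =
      ∏ k ∈ Finset.range n, p (x k) := by
  have h : (cylinderSet fun k : Fin n => x k) =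
      ((Finset.range n : Finset ℕ) : Set ℕ).pi fun k => {x k} := by
    ext y
    simp only [cylinderSet, mem_ofPred_eq, Set.mem_pi, Finset.coe_range, mem_Iio,
      mem_singleton_iff]
    exact ⟨fun h k hk => h ⟨k, hk⟩, fun h k => h k k.2⟩
  rw [h, bernoulliMeasure, Measure.infinitePi_pi _ fun k _ => measurableSet_singleton _]
  exact Finset.prod_congr rfl fun k _ => p.toMeasure_apply_singleton _ (measurableSet_singleton _)

theorem bernoulliMeasure_gibbsWeights_cylinderSet [Nonempty (Fin d)] (r : Fin d → ℝ) (u : ℝ)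
    (n : ℕ) (x : ℕ → Fin d) :
    bernoulliMeasure (gibbsWeights r u) (cylinderSet fun k : Fin n => x k) =
      ENNReal.ofReal (Real.exp (-(u * ∑ k ∈ Finset.range n, r (x k)) -
        n * Real.log (∑ j, Real.exp (-(u * r j))))) := by
  rw [bernoulliMeasure_cylinderSet]
  simp only [gibbsWeights_apply]
  rw [← ENNReal.ofReal_prod_of_nonneg fun i _ => (Real.exp_pos _).le, ← Real.exp_sum,
    Finset.sum_sub_distrib, Finset.sum_const, Finset.card_range, nsmul_eq_mul,
    Finset.sum_neg_distrib, ← Finset.mul_sum]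

theorem HasRates.isGibbsMeasure [Nonempty (Fin d)] {Φ : ConformalIFS d} {r : Fin d → ℝ}
    (h : Φ.HasRates r) (u : ℝ) : Φ.IsGibbsMeasure u (bernoulliMeasure (gibbsWeights r u)) := by
  obtain ⟨K, hK0, hK⟩ := h.abs_mul_birkhoffSum_add_le u
  refine ⟨inferInstance, measurePreserving_leftShift _, Real.exp K, Real.one_le_exp hK0,
    fun n ω x hx => ?_⟩
  rw [← mem_cylinderSet_iff.1 hx, Measure.real, bernoulliMeasure_gibbsWeights_cylinderSet,
    ENNReal.toReal_ofReal (Real.exp_pos _).le, h.pressure_eq, ← Real.exp_neg, ← Real.exp_add,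
    ← Real.exp_add, Real.exp_le_exp, Real.exp_le_exp]
  have := abs_le.1 (hK n x)
  exact ⟨by linarith, by linarith⟩

/-- A common Gibbs measure for the same non-zero parameter and the same pressure forces the
Birkhoff sums to stay at bounded distance from each other. -/
theorem birkhoffSum_bounded_of_isGibbsMeasure {Φ Ψ : ConformalIFS d} {u : ℝ} (hu : u ≠ 0)
    {μ : Measure (ℕ → Fin d)} (hΦ : Φ.IsGibbsMeasure u μ) (hΨ : Ψ.IsGibbsMeasure u μ)
    (hP : Φ.pressure u = Ψ.pressure u) : ∃ K : ℝ, ∀ (n : ℕ) (x : ℕ → Fin d),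
      |birkhoffSum leftShift Φ.potential n x - birkhoffSum leftShift Ψ.potential n x| ≤ K := by
  obtain ⟨-, -, C, hC, h⟩ := hΦ
  obtain ⟨-, -, D, hD, h'⟩ := hΨ
  refine ⟨(Real.log C + Real.log D) / |u|, fun n x => ?_⟩
  rw [le_div_iff₀ (abs_pos.2 hu), ← abs_mul, sub_mul]
  obtain ⟨h1, h2⟩ := h n (fun k => x k) x fun _ => rfl
  obtain ⟨h3, h4⟩ := h' n (fun k => x k) x fun _ => rfl
  have h5 := h1.trans h4
  have h6 := h3.trans h2
  rw [← Real.exp_log (one_pos.trans_le hC), ← Real.exp_log (one_pos.trans_le hD),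
    ← Real.exp_neg, ← Real.exp_add, ← Real.exp_add, Real.exp_le_exp] at h5 h6
  rw [hP] at h5 h6
  exact abs_le.2 ⟨by linarith, by linarith⟩

/-! ### The Lyapunov spectrum -/

/-- The sequences along which the function `r` of the symbols has asymptotic average `α`. -/
def frequencyLevelSet (r : Fin d → ℝ) (α : ℝ) : Set (ℕ → Fin d) :=
  {x | Tendsto (fun n : ℕ => (∑ k ∈ Finset.range n, r (x k)) / n) atTop (𝓝 α)}

theorem HasRates.lyapunovSpectrum_eq {Φ : ConformalIFS d} {r : Fin d → ℝ} (h : Φ.HasRates r)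
    (α : ℝ) : Φ.lyapunovSpectrum α = dimH (Φ.coding '' frequencyLevelSet r α) := by
  obtain ⟨-, K, hK⟩ := h
  have hset : {x : ℕ → Fin d | Tendsto (fun n : ℕ =>
      birkhoffSum leftShift Φ.potential n x / (-(n : ℝ))) atTop (𝓝 α)} =
      frequencyLevelSet r α := by
    ext x
    have h0 : Tendsto (fun n : ℕ => birkhoffSum leftShift Φ.potential n x / (-(n : ℝ)) -
        (∑ k ∈ Finset.range n, r (x k)) / n) atTop (𝓝 0) := by
      refine squeeze_zero_norm (a := fun n : ℕ => K * (1 / (n : ℝ))) (fun n => ?_) ?_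
      · rw [div_neg, ← neg_add', ← add_div, norm_neg, Real.norm_eq_abs, abs_div, Nat.abs_cast,
          mul_one_div]
        exact div_le_div_of_nonneg_right (hK n x) n.cast_nonneg
      · simpa using tendsto_one_div_atTop_nhds_zero_nat.const_mul K
    constructor
    · intro hx
      have h1 := Tendsto.sub hx h0
      simp only [sub_sub_cancel, sub_zero] at h1
      exact h1
    · intro hx
      have h1 := Tendsto.add hx h0
      simp only [add_sub_cancel, add_zero] at h1
      exact h1
  rw [lyapunovSpectrum, hset]

/-- The metric on the limit set in terms of the rates. -/
theorem HasRates.exists_dist_coding_comparable {Φ : ConformalIFS d} {r : Fin d → ℝ}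
    (h : Φ.HasRates r) : ∃ C : ℝ, 0 < C ∧
      (∀ (n : ℕ) (x y : ℕ → Fin d), (∀ k < n, x k = y k) →
        |Φ.coding x - Φ.coding y| ≤ C * Real.exp (-∑ k ∈ Finset.range n, r (x k))) ∧
      ∀ (n : ℕ) (x y : ℕ → Fin d), (∀ k < n, x k = y k) → x n ≠ y n →
        Real.exp (-∑ k ∈ Finset.range n, r (x k)) ≤ C * |Φ.coding x - Φ.coding y| := by
  obtain ⟨-, K, hK⟩ := h
  obtain ⟨C, hC, h1, h2⟩ := Φ.exists_dist_coding_comparable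
  have hC0 : 0 < C := one_pos.trans_le hC
  refine ⟨C * Real.exp K, by positivity, fun n x y hxy => ?_, fun n x y hxy hne => ?_⟩
  · refine (h1 n x y hxy).trans ?_
    rw [mul_assoc, ← Real.exp_add]
    refine mul_le_mul_of_nonneg_left (Real.exp_le_exp.2 ?_) hC0.le
    linarith [(abs_le.1 (hK n x)).2]
  · have h3 := h2 n x y hxy hne
    rw [inv_mul_le_iff₀ hC0] at h3
    calc _ ≤ Real.exp K * Real.exp (birkhoffSum leftShift Φ.potential n x) := by
          rw [← Real.exp_add]
          exact Real.exp_le_exp.2 (by linarith [(abs_le.1 (hK n x)).1])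
      _ ≤ Real.exp K * (C * |Φ.coding x - Φ.coding y|) :=
          mul_le_mul_of_nonneg_left h3 (Real.exp_pos _).le
      _ = _ := by ring

theorem tendsto_mul_add_mul_atTop {s : ℕ → ℝ} {α a b : ℝ}
    (h : Tendsto (fun n : ℕ => s n / n) atTop (𝓝 α)) (hpos : 0 < a * α + b) :
    Tendsto (fun n : ℕ => a * s n + n * b) atTop atTop := by
  have h1 : Tendsto (fun n : ℕ => a * (s n / n) + b) atTop (𝓝 (a * α + b)) :=
    (h.const_mul a).add_const b
  refine (tendsto_natCast_atTop_atTop.atTop_mul_pos hpos h1).congr' ?_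
  filter_upwards [eventually_gt_atTop 0] with n hn
  have hn0 : (n : ℝ) ≠ 0 := by exact_mod_cast hn.ne'
  field_simp

theorem exists_nat_neg_le_mul_add_mul {s : ℕ → ℝ} {α a b : ℝ}
    (h : Tendsto (fun n : ℕ => s n / n) atTop (𝓝 α)) (hpos : 0 < a * α + b) :
    ∃ M : ℕ, ∀ n : ℕ, -(M : ℝ) ≤ a * s n + n * b := by
  obtain ⟨c, hc⟩ := bddBelow_range_of_tendsto_atTop_atTop (tendsto_mul_add_mul_atTop h hpos)
  obtain ⟨M, hM⟩ := exists_nat_ge (-c)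
  exact ⟨M, fun n => (neg_le.1 hM).trans (hc (mem_range_self n))⟩

/-- Upper bound for the Lyapunov spectrum: with `P` the pressure at `u`, the level set of `α` has
dimension at most `s` whenever `P + u α < s α`. Along the level set the quantity
`(s - u) ∑ k < n, r (x k) - n P` is bounded below, so that the natural coverings by cylinder sets
have bounded `s`-volume. -/
theorem HasRates.lyapunovSpectrum_le [Nonempty (Fin d)] {Φ : ConformalIFS d} {r : Fin d → ℝ}
    (h : Φ.HasRates r) {u α : ℝ} {s : NNReal} (hs0 : 0 < s)
    (hs : Φ.pressure u + u * α < s * α) : Φ.lyapunovSpectrum α ≤ s := by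
  rw [h.lyapunovSpectrum_eq]
  rw [h.pressure_eq] at hs
  set P := Real.log (∑ i, Real.exp (-(u * r i))) with hP
  have hs0' : (0 : ℝ) < s := hs0
  let F : ℕ → Set (ℕ → Fin d) := fun M =>
    {x | ∀ n : ℕ, -(M : ℝ) ≤ (s - u) * ∑ k ∈ Finset.range n, r (x k) + n * (-P)}
  have hcov : frequencyLevelSet r α ⊆ ⋃ M, F M := fun x hx =>
    mem_iUnion.2 (exists_nat_neg_le_mul_add_mul hx (by linarith))
  refine (dimH_mono (image_mono hcov)).trans ?_
  rw [image_iUnion, dimH_iUnion]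
  refine iSup_le fun M => dimH_le_of_hausdorffMeasure_ne_top ?_
  obtain ⟨C, hC, hdist, -⟩ := h.exists_dist_coding_comparable
  obtain ⟨θ, B, hθ0, hθ1, hB, -, hθ⟩ := Φ.exists_dist_coding_le
  have hZ : 0 < ∑ i, Real.exp (-(u * r i)) :=
    Finset.sum_pos (fun i _ => Real.exp_pos _) Finset.univ_nonempty
  let t : (n : ℕ) → (Fin n → Fin d) → Set ℝ := fun n ω => Φ.coding '' (cylinderSet ω ∩ F M)
  have hagree : ∀ {n : ℕ} {ω : Fin n → Fin d} {x y : ℕ → Fin d}, x ∈ cylinderSet ω →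
      y ∈ cylinderSet ω → ∀ k < n, x k = y k := fun hx hy k hk =>
    (hx ⟨k, hk⟩).trans (hy ⟨k, hk⟩).symm
  have hterm : ∀ (n : ℕ) (ω : Fin n → Fin d), Metric.ediam (t n ω) ^ (s : ℝ) ≤
      ENNReal.ofReal (C ^ (s : ℝ) * Real.exp M *
        Real.exp (-(u * ∑ k, r (ω k)) - n * P)) := by
    intro n ω
    rcases (cylinderSet ω ∩ F M).eq_empty_or_nonempty with he | ⟨x, hx, hxF⟩
    · simp [t, he, hs0']
    have hsum : ∑ k, r (ω k) = ∑ k ∈ Finset.range n, r (x k) := by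
      rw [← mem_cylinderSet_iff.1 hx, Fin.sum_univ_eq_sum_range (fun k => r (x k))]
    have h1 : Metric.ediam (t n ω) ≤
        ENNReal.ofReal (C * Real.exp (-∑ k ∈ Finset.range n, r (x k))) := by
      refine Metric.ediam_le ?_
      rintro _ ⟨y, ⟨hy, -⟩, rfl⟩ _ ⟨z, ⟨hz, -⟩, rfl⟩
      rw [edist_dist, Real.dist_eq]
      refine ENNReal.ofReal_le_ofReal ((hdist n y z (hagree hy hz)).trans (le_of_eq ?_))
      rw [Finset.sum_congr rfl fun k hk => by rw [hagree hy hx k (Finset.mem_range.1 hk)]]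
    refine (ENNReal.rpow_le_rpow h1 hs0'.le).trans ?_
    rw [ENNReal.ofReal_rpow_of_pos (by positivity)]
    refine ENNReal.ofReal_le_ofReal ?_
    rw [Real.mul_rpow hC.le (Real.exp_pos _).le, ← Real.exp_mul, mul_assoc, ← Real.exp_add, hsum]
    refine mul_le_mul_of_nonneg_left (Real.exp_le_exp.2 ?_) (by positivity)
    linarith [hxF n]
  have hsumle : ∀ n : ℕ, ∑ ω : Fin n → Fin d, Metric.ediam (t n ω) ^ (s : ℝ) ≤
      ENNReal.ofReal (C ^ (s : ℝ) * Real.exp M) := by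
    intro n
    refine (Finset.sum_le_sum fun ω _ => hterm n ω).trans (le_of_eq ?_)
    rw [← ENNReal.ofReal_sum_of_nonneg fun ω _ => by positivity, ← Finset.mul_sum]
    congr 1
    have h2 : ∀ ω : Fin n → Fin d, Real.exp (-(u * ∑ k, r (ω k)) - n * P) =
        (∏ k, Real.exp (-(u * r (ω k)))) * Real.exp (-(n * P)) := fun ω => by
      rw [← Real.exp_sum, ← Real.exp_add, Finset.sum_neg_distrib, Finset.mul_sum, sub_eq_add_neg]
    rw [Finset.sum_congr rfl fun ω _ => h2 ω, ← Finset.sum_mul,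
      ← Fintype.sum_pow (fun i => Real.exp (-(u * r i))), Real.exp_neg, Real.exp_nat_mul, hP,
      Real.exp_log hZ, mul_inv_cancel₀ (by positivity), mul_one]
  have hle := Measure.hausdorffMeasure_le_liminf_sum (l := atTop) (s : ℝ) (Φ.coding '' F M)
    (fun n : ℕ => ENNReal.ofReal (B * θ ^ n)) (by
      rw [← ENNReal.ofReal_zero]
      refine ENNReal.tendsto_ofReal ?_
      simpa using (tendsto_pow_atTop_nhds_zero_of_lt_one hθ0 hθ1).const_mul B) t
    (Eventually.of_forall fun n ω => by
      refine Metric.ediam_le ?_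
      rintro _ ⟨y, ⟨hy, -⟩, rfl⟩ _ ⟨z, ⟨hz, -⟩, rfl⟩
      rw [edist_dist, Real.dist_eq]
      exact ENNReal.ofReal_le_ofReal (hθ n y z (hagree hy hz)))
    (Eventually.of_forall fun n => by
      rintro _ ⟨x, hx, rfl⟩
      exact mem_iUnion.2 ⟨fun k => x k, x, ⟨fun _ => rfl, hx⟩, rfl⟩)
  refine ne_top_of_le_ne_top (ENNReal.ofReal_ne_top (r := C ^ (s : ℝ) * Real.exp M))
    (hle.trans ?_)
  exact (liminf_le_liminf (Eventually.of_forall hsumle)).trans_eq (liminf_const _)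

/-- The strong law of large numbers for a Bernoulli measure. -/
theorem ae_mem_frequencyLevelSet (p : PMF (Fin d)) (r : Fin d → ℝ) :
    ∀ᵐ x ∂bernoulliMeasure p, x ∈ frequencyLevelSet r (∑ i, (p i).toReal * r i) := by
  have hr : Measurable r := measurable_of_finite r
  have hmp : ∀ k : ℕ, MeasurePreserving (Function.eval k) (bernoulliMeasure p) p.toMeasure :=
    fun k => measurePreserving_eval_infinitePi (fun _ => p.toMeasure) k
  have hmeas : ∀ k : ℕ, Measurable fun x : ℕ → Fin d => r (x k) := fun k =>
    hr.comp (measurable_pi_apply k)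
  have hint : ∫ x, r (x 0) ∂bernoulliMeasure p = ∑ i, (p i).toReal * r i := by
    have h1 := (hmp 0).map_eq
    have h2 : ∫ i, r i ∂p.toMeasure = ∫ x, r (x 0) ∂bernoulliMeasure p := by
      rw [← h1]
      exact integral_map (hmp 0).measurable.aemeasurable hr.aestronglyMeasurable
    rw [← h2, PMF.integral_eq_sum]
    rfl
  have h := ProbabilityTheory.strong_law_ae_real (μ := bernoulliMeasure p)
    (fun k x => r (x k)) ?_ ?_ ?_
  · rw [hint] at h
    exact h
  · refine Integrable.of_bound (hmeas 0).aestronglyMeasurable (∑ i, |r i|)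
      (Eventually.of_forall fun x => ?_)
    exact Finset.single_le_sum (f := fun i => |r i|) (fun i _ => abs_nonneg _)
      (Finset.mem_univ (x 0))
  · intro i j hij
    exact (ProbabilityTheory.iIndepFun_infinitePi (P := fun _ : ℕ => p.toMeasure)
      (X := fun _ => r) fun _ => hr).indepFun hij
  · intro k
    refine ⟨(hmeas k).aemeasurable, (hmeas 0).aemeasurable, ?_⟩
    have h1 : ∀ k : ℕ, (bernoulliMeasure p).map (fun x : ℕ → Fin d => r (x k)) =
        p.toMeasure.map r := fun k => by
      rw [← (hmp k).map_eq, Measure.map_map hr (hmp k).measurable]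
      rfl
    rw [h1, h1]

/-- Lower bound for the dimension of a level set charged by a Bernoulli measure of Gibbs type, by
the mass distribution principle. -/
theorem HasRates.le_lyapunovSpectrum_of_ae [Nonempty (Fin d)] {Φ : ConformalIFS d}
    {r : Fin d → ℝ} (h : Φ.HasRates r) {u α : ℝ} (hα : 0 < α)
    (hae : ∀ᵐ x ∂bernoulliMeasure (gibbsWeights r u), x ∈ frequencyLevelSet r α)
    {s : NNReal} (hs : s * α < Φ.pressure u + u * α) : s ≤ Φ.lyapunovSpectrum α := by
  rcases eq_or_ne s 0 with rfl | hs0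
  · simp
  have hs0' : (0 : ℝ) < s := NNReal.coe_pos.2 (pos_iff_ne_zero.2 hs0)
  rw [h.lyapunovSpectrum_eq]
  rw [h.pressure_eq] at hs
  set P := Real.log (∑ i, Real.exp (-(u * r i))) with hP
  set μ := bernoulliMeasure (gibbsWeights r u) with hμ
  obtain ⟨C, hC, -, hdist⟩ := h.exists_dist_coding_comparable
  let E := frequencyLevelSet r α
  -- On `F M` cylinder sets have mass at most `exp M` times `exp (-∑ k < n, r (x k))` to the power
  -- `s`, that is, comparable to their diameter to the power `s`.
  let F : ℕ → Set (ℕ → Fin d) := fun M => E ∩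
    {x | ∀ n : ℕ, -(M : ℝ) ≤ (u - s) * ∑ k ∈ Finset.range n, r (x k) + n * P}
  have hcov : E ⊆ ⋃ M, F M := fun x hx => by
    obtain ⟨M, hM⟩ := exists_nat_neg_le_mul_add_mul hx
      (show 0 < (u - s) * α + P by linarith)
    exact mem_iUnion.2 ⟨M, hx, hM⟩
  have hne : μ (⋃ M, F M) ≠ 0 := fun h0 => by
    have h1 : ∀ᵐ x ∂μ, x ∉ ⋃ M, F M := measure_eq_zero_iff_ae_notMem.1 h0
    obtain ⟨x, hx, hx'⟩ := (hae.and h1).exists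
    exact hx' (hcov hx)
  obtain ⟨M, hM⟩ := exists_measure_pos_of_not_measure_iUnion_null hne
  have hcyl : ∀ x ∈ F M, ∀ n : ℕ, μ (cylinderSet fun k : Fin n => x k) ≤
      ENNReal.ofReal (Real.exp M * Real.exp (-∑ k ∈ Finset.range n, r (x k)) ^ (s : ℝ)) := by
    intro x hx n
    rw [hμ, bernoulliMeasure_gibbsWeights_cylinderSet, ← Real.exp_mul, ← Real.exp_add]
    refine ENNReal.ofReal_le_ofReal (Real.exp_le_exp.2 ?_)
    linarith [hx.2 n]
  have hpoint : ∀ x ∈ F M, μ {x} = 0 := by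
    intro x hx
    have hlim : Tendsto (fun n : ℕ => ENNReal.ofReal
        (Real.exp M * Real.exp (-∑ k ∈ Finset.range n, r (x k)) ^ (s : ℝ))) atTop (𝓝 0) := by
      rw [← ENNReal.ofReal_zero]
      refine ENNReal.tendsto_ofReal ?_
      have h1 : Tendsto (fun n : ℕ => (s : ℝ) * ∑ k ∈ Finset.range n, r (x k) + n * 0)
          atTop atTop := tendsto_mul_add_mul_atTop hx.1 (by positivity)
      have h2 := (Real.tendsto_exp_neg_atTop_nhds_zero.comp h1).const_mul (Real.exp M)
      rw [mul_zero] at h2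
      refine h2.congr fun n => ?_
      rw [← Real.exp_mul, Function.comp_apply]
      congr 2
      ring
    refine le_antisymm (ge_of_tendsto' hlim fun n => ?_) zero_le
    refine (measure_mono ?_).trans (hcyl x hx n)
    rintro _ rfl
    exact fun _ => rfl
  set D := Real.exp M * C ^ (s : ℝ) with hD
  have hD0 : 0 < D := by positivity
  have hmass : ∀ A : Set ℝ, μ (Φ.coding ⁻¹' closure A ∩ F M) ≤
      ENNReal.ofReal D * Metric.ediam A ^ (s : ℝ) := by
    intro A
    set T := Φ.coding ⁻¹' closure A ∩ F M
    by_cases hsub : T.Subsingleton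
    · rcases hsub.eq_empty_or_singleton with he | ⟨x, hx⟩
      · simp [he]
      · have hxT : x ∈ T := hx ▸ mem_singleton x
        rw [hx, hpoint x hxT.2]
        exact zero_le
    -- The smallest position at which two codes in `T` differ gives a cylinder set around `T`.
    have hex : ∃ n, ∃ x ∈ T, ∃ y ∈ T, x n ≠ y n := by
      rw [not_subsingleton_iff] at hsub
      obtain ⟨x, hx, y, hy, hxy⟩ := hsub
      obtain ⟨n, hn⟩ := Function.ne_iff.1 hxy
      exact ⟨n, x, hx, y, hy, hn⟩
    classical
    obtain ⟨x, hx, y, hy, hxy⟩ := Nat.find_spec hex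
    have hag : ∀ z ∈ T, ∀ k < Nat.find hex, z k = x k := by
      intro z hz k hk
      by_contra hne
      exact Nat.find_min hex hk ⟨z, hz, x, hx, hne⟩
    set n := Nat.find hex
    have h1 : T ⊆ cylinderSet fun k : Fin n => x k := fun z hz k => hag z hz k k.2
    refine ((measure_mono h1).trans (hcyl x hx.2 n)).trans ?_
    have h2 := hdist n x y (fun k hk => (hag y hy k hk).symm) hxy
    have h3 : Real.exp M * Real.exp (-∑ k ∈ Finset.range n, r (x k)) ^ (s : ℝ) ≤
        D * |Φ.coding x - Φ.coding y| ^ (s : ℝ) := by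
      rw [hD, mul_assoc, ← Real.mul_rpow hC.le (abs_nonneg _)]
      exact mul_le_mul_of_nonneg_left (Real.rpow_le_rpow (Real.exp_pos _).le h2 hs0'.le)
        (Real.exp_pos _).le
    refine (ENNReal.ofReal_le_ofReal h3).trans ?_
    rw [ENNReal.ofReal_mul hD0.le, ← ENNReal.ofReal_rpow_of_nonneg (abs_nonneg _) hs0'.le,
      ← Real.dist_eq, ← edist_dist]
    refine mul_le_mul_right (ENNReal.rpow_le_rpow ?_ hs0'.le) _
    rw [← Metric.ediam_closure]
    exact Metric.edist_le_ediam_of_mem hx.1 hy.1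
  have hDne : ENNReal.ofReal D ≠ 0 := (ENNReal.ofReal_pos.2 hD0).ne'
  have hcm : Measurable Φ.coding := Φ.continuous_coding.measurable
  have hle := Measure.le_hausdorffMeasure (s : ℝ)
    ((ENNReal.ofReal D)⁻¹ • (μ.restrict (F M)).map Φ.coding) 1 one_pos fun A _ => by
      rw [Measure.smul_apply, smul_eq_mul, ENNReal.inv_mul_le_iff hDne ENNReal.ofReal_ne_top]
      refine le_trans ?_ (hmass A)
      refine (measure_mono subset_closure).trans (le_of_eq ?_)
      rw [Measure.map_apply hcm isClosed_closure.measurableSet,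
        Measure.restrict_apply (hcm isClosed_closure.measurableSet)]
  refine le_dimH_of_hausdorffMeasure_ne_zero (ne_of_gt ?_)
  refine lt_of_lt_of_le ?_ (hle (Φ.coding '' E))
  rw [Measure.smul_apply, smul_eq_mul]
  refine ENNReal.mul_pos (ENNReal.inv_ne_zero.2 ENNReal.ofReal_ne_top) (ne_of_gt ?_)
  refine lt_of_lt_of_le ?_ (Measure.le_map_apply hcm.aemeasurable _)
  refine hM.trans_le ?_
  rw [← Measure.restrict_apply_self]
  exact measure_mono fun x hx => ⟨x, hx.1, rfl⟩

/-- For every `u` the Bernoulli measure with the weights `p i = exp (-u r i - P)` witnesses the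
Legendre duality at `u`: its mean rate `α` satisfies `α ℓ(α) ≥ P(u) + u α > 0`, the right-hand side
being the entropy of `p`. -/
theorem HasRates.exists_le_lyapunovSpectrum [Nontrivial (Fin d)] {Φ : ConformalIFS d}
    {r : Fin d → ℝ} (h : Φ.HasRates r) (u : ℝ) :
    ∃ α : ℝ, 0 < α ∧ 0 < Φ.pressure u + u * α ∧
      ∀ s : NNReal, s * α < Φ.pressure u + u * α → s ≤ Φ.lyapunovSpectrum α := by
  set P := Real.log (∑ i, Real.exp (-(u * r i))) with hP
  have hZ : 0 < ∑ i, Real.exp (-(u * r i)) :=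
    Finset.sum_pos (fun i _ => Real.exp_pos _) Finset.univ_nonempty
  have hw : ∀ i, (gibbsWeights r u i).toReal = Real.exp (-(u * r i) - P) := fun i => by
    rw [gibbsWeights_apply, ENNReal.toReal_ofReal (Real.exp_pos _).le]
  have hw1 : ∑ i, (gibbsWeights r u i).toReal = 1 := by
    simp only [hw, Real.exp_sub, ← Finset.sum_div, hP, Real.exp_log hZ]
    exact div_self hZ.ne'
  have hα : 0 < ∑ i, (gibbsWeights r u i).toReal * r i :=
    Finset.sum_pos (fun i _ => mul_pos (hw i ▸ Real.exp_pos _) (h.1 i)) Finset.univ_nonempty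
  refine ⟨_, hα, ?_, fun s hs =>
    h.le_lyapunovSpectrum_of_ae hα (ae_mem_frequencyLevelSet _ _) hs⟩
  have h1 : Φ.pressure u + u * ∑ i, (gibbsWeights r u i).toReal * r i =
      ∑ i, (gibbsWeights r u i).toReal * (P + u * r i) := by
    simp only [mul_add, Finset.sum_add_distrib, ← Finset.sum_mul, hw1, one_mul, h.pressure_eq,
      Finset.mul_sum]
    congr 1
    exact Finset.sum_congr rfl fun i _ => by ring
  rw [h1]
  refine Finset.sum_pos (fun i _ => mul_pos (hw i ▸ Real.exp_pos _) ?_) Finset.univ_nonempty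
  obtain ⟨j, hj⟩ := exists_ne i
  have h2 : Real.exp (-(u * r i)) < ∑ i, Real.exp (-(u * r i)) :=
    Finset.single_lt_sum (f := fun i => Real.exp (-(u * r i))) hj (Finset.mem_univ i)
      (Finset.mem_univ j) (Real.exp_pos _) fun k _ _ => (Real.exp_pos _).le
  have h3 := (Real.lt_log_iff_exp_lt hZ).2 h2
  linarith

/-- The Lyapunov spectrum determines the pressure: at an `α` realising the Legendre duality for `Φ`
at `u`, the lower bound for `Φ` and the upper bound for `Ψ` force `P_Φ(u) ≤ P_Ψ(u)`. -/
theorem HasRates.pressure_le_of_lyapunovSpectrum_eq [Nontrivial (Fin d)] {Φ Ψ : ConformalIFS d}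
    {r s : Fin d → ℝ} (hΦ : Φ.HasRates r) (hΨ : Ψ.HasRates s)
    (h : Φ.lyapunovSpectrum = Ψ.lyapunovSpectrum) (u : ℝ) : Φ.pressure u ≤ Ψ.pressure u := by
  by_contra! hlt
  obtain ⟨α, hα, hpos, hge⟩ := hΦ.exists_le_lyapunovSpectrum u
  -- Exponents `0 < a < b` with `ℓ_Ψ(α) ≤ a < b ≤ ℓ_Φ(α)`; positivity of `P_Φ(u) + u α` gives room.
  have h1 : max 0 ((Ψ.pressure u + u * α) / α) < (Φ.pressure u + u * α) / α :=
    max_lt (by positivity) (div_lt_div_of_pos_right (by linarith) hα)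
  obtain ⟨a, ha1, ha2⟩ := exists_between h1
  obtain ⟨b, hb1, hb2⟩ := exists_between ha2
  have ha0 : 0 < a := (le_max_left _ _).trans_lt ha1
  have ha3 := (le_max_right _ _).trans_lt ha1
  have hb0 : 0 < b := ha0.trans hb1
  lift a to NNReal using ha0.le
  lift b to NNReal using hb0.le
  have h2 := hΨ.lyapunovSpectrum_le (NNReal.coe_pos.1 ha0) ((div_lt_iff₀ hα).1 ha3)
  have h3 := hge b ((lt_div_iff₀ hα).1 hb2)
  rw [h] at h3
  exact absurd (ENNReal.coe_le_coe.1 (h3.trans h2)) (not_le.2 (NNReal.coe_lt_coe.1 hb1))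

/-- The Lyapunov spectrum depends on the rates only: the level sets of two systems with the same
rates are bi-Lipschitz images of each other. -/
theorem HasRates.lyapunovSpectrum_congr {Φ Ψ : ConformalIFS d} {r : Fin d → ℝ}
    [Nonempty (Fin d)] (hΦ : Φ.HasRates r) (hΨ : Ψ.HasRates r) :
    Φ.lyapunovSpectrum = Ψ.lyapunovSpectrum := by
  have key : ∀ {Φ Ψ : ConformalIFS d}, Φ.HasRates r → Ψ.HasRates r → ∀ α,
      Φ.lyapunovSpectrum α ≤ Ψ.lyapunovSpectrum α := by
    intro Φ Ψ hΦ hΨ α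
    obtain ⟨K, hK⟩ := hΦ.birkhoffSum_bounded hΨ
    obtain ⟨L, hL, h1⟩ := exists_dist_coding_le_of_birkhoffSum_le (Φ := Ψ) (Ψ := Φ) (K := K)
      fun n x => by linarith [(abs_le.1 (hK n x)).2]
    rw [hΦ.lyapunovSpectrum_eq, hΨ.lyapunovSpectrum_eq]
    let g : ℝ → ℝ := Φ.coding ∘ Function.invFun Ψ.coding
    have hg : ∀ x, g (Ψ.coding x) = Φ.coding x := fun x =>
      congrArg Φ.coding (Function.leftInverse_invFun Ψ.coding_injective x)
    have himg : Φ.coding '' frequencyLevelSet r α =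
        g '' (Ψ.coding '' frequencyLevelSet r α) := by
      rw [image_image]
      exact image_congr fun x _ => (hg x).symm
    rw [himg]
    refine LipschitzOnWith.dimH_image_le (K := ⟨L, zero_le_one.trans hL⟩)
      (LipschitzOnWith.of_dist_le_mul ?_)
    rintro _ ⟨x, -, rfl⟩ _ ⟨y, -, rfl⟩
    rw [hg, hg, Real.dist_eq, Real.dist_eq]
    exact h1 x y
  exact funext fun α => le_antisymm (key hΦ hΨ α) (key hΨ hΦ α)

theorem HasRates.lyapunovSpectrum_permute {Φ : ConformalIFS d} {r : Fin d → ℝ}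
    (h : Φ.HasRates r) (τ : Equiv.Perm (Fin d)) :
    (Φ.permute τ).lyapunovSpectrum = Φ.lyapunovSpectrum := by
  funext α
  rw [h.lyapunovSpectrum_eq, (h.permute τ).lyapunovSpectrum_eq]
  congr 1
  ext p
  constructor
  · rintro ⟨x, hx, rfl⟩
    exact ⟨fun k => τ (x k), hx, (Φ.coding_permute τ x).symm⟩
  · rintro ⟨x, hx, rfl⟩
    refine ⟨fun k => τ.symm (x k), ?_, ?_⟩
    · simpa [frequencyLevelSet] using hx
    · simp [coding_permute]

end ConformalIFS

/-! ### The equivalence of the five conditions -/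

theorem mainTheorem3 (d : ℕ) (hd : 2 ≤ d) (Φ Ψ : ConformalIFS d)
    (hΦ : Φ.IsEssentiallyAffine) (hΨ : Ψ.IsEssentiallyAffine)
    (hΦnd : ¬ Φ.IsDegenerate) (hΨnd : ¬ Ψ.IsDegenerate) :
    List.TFAE [
      ∃ u : ℝ, u ≠ 0 ∧ Φ.GibbsEqualUpToPerm u Ψ u ∧ Φ.pressure u = Ψ.pressure u,
      Φ.Equivalent Ψ,
      Φ.PotentialEquiv Ψ,
      Φ.pressure = Ψ.pressure,
      Φ.lyapunovSpectrum = Ψ.lyapunovSpectrum] := by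
  have : Nontrivial (Fin d) := Fin.nontrivial_iff_two_le.2 hd
  obtain ⟨r, hr⟩ := hΦ.exists_hasRates
  obtain ⟨s, hs⟩ := hΨ.exists_hasRates
  tfae_have 2 ↔ 3 := exists_congr fun τ =>
    (Φ.isDeformation_iff_birkhoffSum_bounded (Ψ.permute τ)).trans
      (Φ.isCohomologous_potential_iff_birkhoffSum_bounded (Ψ.permute τ)).symm
  tfae_have 1 → 3 := by
    rintro ⟨u, hu, ⟨τ, μ, h1, h2⟩, hP⟩
    rw [← ConformalIFS.pressure_permute hs τ] at hP
    exact ⟨τ, (ConformalIFS.isCohomologous_potential_iff_birkhoffSum_bounded _ _).2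
      (ConformalIFS.birkhoffSum_bounded_of_isGibbsMeasure hu h1 h2 hP)⟩
  have key : ∀ {τ : Equiv.Perm (Fin d)}, r = s ∘ τ → (Ψ.permute τ).HasRates r := fun h =>
    h ▸ hs.permute _
  tfae_have 4 → 1 := by
    intro hP
    obtain ⟨τ, hτ⟩ := hr.exists_perm_of_pressure_eq hs hP
    exact ⟨1, one_ne_zero, ⟨τ, _, hr.isGibbsMeasure 1, (key hτ).isGibbsMeasure 1⟩,
      congrFun hP 1⟩
  tfae_have 3 → 5 := by
    rintro ⟨τ, h⟩
    obtain ⟨K, hK⟩ := (ConformalIFS.isCohomologous_potential_iff_birkhoffSum_bounded _ _).1 h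
    have hτ : r = s ∘ τ := hr.unique_of_birkhoffSum_bounded (hs.permute τ) hK
    rw [hr.lyapunovSpectrum_congr (key hτ), hs.lyapunovSpectrum_permute]
  tfae_have 5 → 4 := fun h => funext fun u =>
    le_antisymm (hr.pressure_le_of_lyapunovSpectrum_eq hs h u)
      (hs.pressure_le_of_lyapunovSpectrum_eq hr h.symm u)
  tfae_finish
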